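/- Let $K$ be a finite extension of $\mathbb{Q}_p$ with ring of integers $\mathcal{O}$, uniformizer $\pi$ and residue field of order $q$. Let $R$ be a $\pi$-adically complete (and separated), $\pi$-torsion free $\mathcal{O}$-algebra with a lift of Frobenius $\phi$, i.e. an $\mathcal{O}$-algebra endomorphism with $\phi(r)-r^q\in\pi R$ for all $r\in R$. For an $R$-algebra $C$ let $W_n(C)$ be the ring of $\pi$-typical (ramified) Witt vectors of length $n+1$ over $C$, made into an $R$-algebra by $R\to W_n(R)\to W_n(C)$, where $R\to W_n(R)$ is the ring homomorphism with ghost components $(\mathrm{id},\phi,\dots,\phi^n)$. Regard formal schemes over $R$ as Zariski sheaves on (the opposite of) the category $\mathrm{Nilp}_R$ of $R$-algebras on which $\pi$ is nilpotent that admit an open cover by subfunctors $\mathrm{Spf}(A)$, with $A$ an adic $R$-algebra having an ideal of definition that contains $\pi$. For a functor $G$ from $\mathrm{Nilp}_R$ to groups put $J^nG(C)=G(W_n(C))$ and $N^nG=\ker(J^nG\to G)$, where $J^nG\to G$ is induced by the projection $W_n(C)\to C$ to the first coordinate. Then for every smooth formal group scheme $G$ over $R$ and every integer $n\ge 1$ there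 is an isomorphism of formal group schemes over $R$ $$N^nG\;\simeq\;J^{n-1}(N^1G).$$ -/

import Mathlib

open CategoryTheory

universe u

/-! ## Ramified (`π`-typical) Witt vectors of finite length

`𝒪` is a domain and `π` a prime element of `𝒪` with finite residue ring `𝒪 ⧸ (π)`, of
cardinality `q`. -/

namespace RamifiedWitt

section Congruences

variable {A : Type*} [CommRing A] {ϖ : A} {q : ℕ}

theorem dvd_pow_sub_pow (hq : ϖ ∣ (q : A)) {k : ℕ} {a b : A}
    (h : ϖ ^ (k + 1) ∣ a - b) : ϖ ^ (k + 2) ∣ a ^ q - b ^ q := by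
  have h1 : ϖ ∣ a - b := (dvd_pow_self ϖ (Nat.succ_ne_zero k)).trans h
  have h2 : ϖ ∣ ∑ i ∈ Finset.range q, a ^ i * b ^ (q - 1 - i) := by
    have e : (∑ i ∈ Finset.range q, a ^ i * b ^ (q - 1 - i)) =
        (∑ i ∈ Finset.range q, (a ^ i - b ^ i) * b ^ (q - 1 - i)) + q * b ^ (q - 1) := by
      have : (q : A) * b ^ (q - 1) = ∑ i ∈ Finset.range q, b ^ i * b ^ (q - 1 - i) := by
        rw [Finset.sum_congr rfl (g := fun _ => b ^ (q - 1))]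
        · simp
        · intro i hi
          rw [← pow_add]
          congr 1
          have := Finset.mem_range.1 hi
          omega
      rw [this, ← Finset.sum_add_distrib]
      exact Finset.sum_congr rfl fun i _ => by ring
    rw [e]
    refine dvd_add (Finset.dvd_sum fun i _ => ?_) (hq.mul_right _)
    exact (h1.trans (sub_dvd_pow_sub_pow a b i)).mul_right _
  rw [← (Commute.all a b).geom_sum₂_mul, pow_succ, mul_comm]
  exact mul_dvd_mul h2 h |>.trans (by rw [mul_comm])

theorem dvd_pow_pow_sub_pow_pow (hq : ϖ ∣ (q : A)) {a b : A} (h : ϖ ∣ a - b) (m : ℕ) :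
    ϖ ^ (m + 1) ∣ a ^ q ^ m - b ^ q ^ m := by
  induction m with
  | zero => simpa using h
  | succ m ih =>
    rw [pow_succ q, pow_mul, pow_mul]
    exact dvd_pow_sub_pow hq ih

end Congruences

variable {𝒪 : Type*} [CommRing 𝒪] (π : 𝒪)

/-- The cardinality `q` of the residue ring `𝒪 ⧸ (π)`. -/
noncomputable def resCard : ℕ := Nat.card (𝒪 ⧸ Ideal.span {π})

/-- The `n`-th ghost polynomial
`w_n = x₀ ^ (q ^ n) + π x₁ ^ (q ^ (n - 1)) + ⋯ + π ^ n x_n`, evaluated at `x`. -/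
noncomputable def ghost {A : Type*} [CommRing A] [Algebra 𝒪 A] (x : ℕ → A) (n : ℕ) : A :=
  ∑ j ∈ Finset.range (n + 1), algebraMap 𝒪 A π ^ j * x j ^ resCard π ^ (n - j)

/-- `A` has no `π`-torsion. -/
class PiTorsionFree (A : Type*) [CommRing A] [Algebra 𝒪 A] : Prop where
  eq_zero : ∀ a : A, algebraMap 𝒪 A π * a = 0 → a = 0

theorem ghost_map {A B : Type*} [CommRing A] [Algebra 𝒪 A] [CommRing B] [Algebra 𝒪 B]
    (f : A →ₐ[𝒪] B) (x : ℕ → A) (n : ℕ) : ghost π (fun i => f (x i)) n = f (ghost π x n) := by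
  simp [ghost, map_sum]

theorem ghost_congr {A : Type*} [CommRing A] [Algebra 𝒪 A] {x y : ℕ → A} {n : ℕ}
    (h : ∀ i ≤ n, x i = y i) : ghost π x n = ghost π y n := by
  refine Finset.sum_congr rfl fun j hj => ?_
  rw [h j (Nat.lt_succ_iff.1 (Finset.mem_range.1 hj))]

theorem ghost_succ {A : Type*} [CommRing A] [Algebra 𝒪 A] (x : ℕ → A) (n : ℕ) :
    ghost π x (n + 1) = (∑ j ∈ Finset.range (n + 1),
      algebraMap 𝒪 A π ^ j * x j ^ resCard π ^ (n + 1 - j)) +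
        algebraMap 𝒪 A π ^ (n + 1) * x (n + 1) := by
  rw [ghost, Finset.sum_range_succ]
  simp

theorem PiTorsionFree.pow_mul_cancel {A : Type*} [CommRing A] [Algebra 𝒪 A] [PiTorsionFree π A]
    (n : ℕ) {a b : A} (h : algebraMap 𝒪 A π ^ n * a = algebraMap 𝒪 A π ^ n * b) : a = b := by
  induction n with
  | zero => simpa using h
  | succ n ih =>
    apply ih
    rw [← sub_eq_zero]
    apply PiTorsionFree.eq_zero (π := π)
    rw [mul_sub, ← mul_assoc, ← mul_assoc, ← pow_succ', h, sub_self]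

theorem eq_of_ghost_eq {A : Type*} [CommRing A] [Algebra 𝒪 A] [PiTorsionFree π A]
    {x y : ℕ → A} {n : ℕ} (h : ∀ i ≤ n, ghost π x i = ghost π y i) : ∀ i ≤ n, x i = y i := by
  intro i
  induction i using Nat.strong_induction_on with
  | _ i ih =>
    intro hi
    have h' := h i hi
    rw [ghost, ghost, Finset.sum_range_succ, Finset.sum_range_succ,
      Finset.sum_congr rfl (g := fun j => algebraMap 𝒪 A π ^ j * y j ^ resCard π ^ (i - j))] at h'
    · have h2 := add_left_cancel h'
      simp only [Nat.sub_self, pow_zero, pow_one] at h2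
      exact PiTorsionFree.pow_mul_cancel π i h2
    · intro j hj
      have hj' := Finset.mem_range.1 hj
      rw [ih j hj' (by omega)]

/-- The ghost vectors in a ring with a lift `ψ` of the `q`-Frobenius satisfy the congruences of
Dwork's lemma. -/
theorem ghost_dvd {A : Type*} [CommRing A] [Algebra 𝒪 A] (ψ : A →ₐ[𝒪] A)
    (hψ : ∀ a, algebraMap 𝒪 A π ∣ ψ a - a ^ resCard π)
    (hq : algebraMap 𝒪 A π ∣ (resCard π : A)) (x : ℕ → A) (n : ℕ) :
    algebraMap 𝒪 A π ^ (n + 1) ∣ ghost π x (n + 1) - ψ (ghost π x n) := by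
  rw [ghost_succ, ghost, map_sum, add_sub_right_comm, ← Finset.sum_sub_distrib]
  refine dvd_add (Finset.dvd_sum fun j hj => ?_) (Dvd.intro _ rfl)
  have hj' := Finset.mem_range.1 hj
  have h1 := dvd_pow_pow_sub_pow_pow hq (hψ (x j)) (n - j)
  have e : n + 1 - j = (n - j) + 1 := by omega
  simp only [map_mul, map_pow, AlgHom.commutes]
  rw [← mul_sub, show n + 1 = j + (n - j + 1) by omega, pow_add]
  refine mul_dvd_mul_left _ ?_
  rw [show j + (n - j + 1) - j = (n - j) + 1 by omega, pow_succ' (resCard π), pow_mul, dvd_sub_comm]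
  exact h1

/-- Dwork's lemma. -/
theorem exists_ghost_eq {A : Type*} [CommRing A] [Algebra 𝒪 A] [PiTorsionFree π A] (ψ : A →ₐ[𝒪] A)
    (hψ : ∀ a, algebraMap 𝒪 A π ∣ ψ a - a ^ resCard π)
    (hq : algebraMap 𝒪 A π ∣ (resCard π : A)) (g : ℕ → A)
    (hg : ∀ n, algebraMap 𝒪 A π ^ (n + 1) ∣ g (n + 1) - ψ (g n)) :
    ∃ x : ℕ → A, ∀ n, ghost π x n = g n := by
  have key : ∀ n, ∃ x : ℕ → A, ∀ i ≤ n, ghost π x i = g i := by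
    intro n
    induction n with
    | zero => exact ⟨fun _ => g 0, fun i hi => by simp [Nat.le_zero.1 hi, ghost]⟩
    | succ n ih =>
      obtain ⟨x, hx⟩ := ih
      have h1 := ghost_dvd π ψ hψ hq x n
      rw [hx n le_rfl] at h1
      obtain ⟨c, hc⟩ := dvd_sub (hg n) h1
      refine ⟨Function.update x (n + 1) (x (n + 1) + c), fun i hi => ?_⟩
      rcases Nat.lt_or_ge i (n + 1) with h | h
      · rw [← hx i (by omega)]
        refine ghost_congr π fun j hj => ?_
        rw [Function.update_of_ne (by omega)]
      · obtain rfl : i = n + 1 := by omega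
        rw [ghost_succ, Finset.sum_congr rfl
          (g := fun j => algebraMap 𝒪 A π ^ j * x j ^ resCard π ^ (n + 1 - j))]
        · rw [Function.update_self, mul_add, ← add_assoc, ← ghost_succ]
          linear_combination -hc
        · intro j hj
          have hj' := Finset.mem_range.1 hj
          rw [Function.update_of_ne (by omega)]
  choose x hx using key
  refine ⟨fun i => x i i, fun n => ?_⟩
  rw [← hx n n le_rfl]
  refine ghost_congr π fun i hi => ?_
  refine eq_of_ghost_eq π (n := i) (fun j hj => ?_) i le_rfl
  rw [hx i j hj, hx n j (hj.trans hi)]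

section StructurePolynomials

variable [IsDomain 𝒪] [hπ : Fact (Prime π)] [hfin : Finite (𝒪 ⧸ Ideal.span {π})]

theorem isPrime_span : (Ideal.span {π}).IsPrime :=
  (Ideal.span_singleton_prime hπ.out.ne_zero).2 hπ.out

theorem resCard_eq : ∃ p f : ℕ, p.Prime ∧ resCard π = p ^ f ∧ π ∣ (p : 𝒪) ∧ f ≠ 0 ∧
    ∀ a : 𝒪, π ∣ a - a ^ resCard π := by
  have := isPrime_span π
  classical
  let _ : Fintype (𝒪 ⧸ Ideal.span {π}) := Fintype.ofFinite _
  let _ : Field (𝒪 ⧸ Ideal.span {π}) := Fintype.fieldOfDomain _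
  obtain ⟨p, hp, n, hpp, hn⟩ := FiniteField.card' (𝒪 ⧸ Ideal.span {π})
  have hc : resCard π = Fintype.card (𝒪 ⧸ Ideal.span {π}) := Nat.card_eq_fintype_card
  refine ⟨p, n, hpp, hc.trans hn, ?_, n.pos.ne', fun a => ?_⟩
  · rw [← Ideal.mem_span_singleton, ← Ideal.Quotient.eq_zero_iff_mem, map_natCast]
    exact CharP.cast_eq_zero _ p
  · rw [← Ideal.mem_span_singleton, ← Ideal.Quotient.eq_zero_iff_mem, map_sub, map_pow, hc,
      FiniteField.pow_card, sub_self]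

theorem dvd_resCard (A : Type*) [CommRing A] [Algebra 𝒪 A] :
    algebraMap 𝒪 A π ∣ (resCard π : A) := by
  obtain ⟨p, f, -, hq, hp, hf, -⟩ := resCard_eq π
  rw [hq, Nat.cast_pow]
  refine dvd_pow ?_ hf
  simpa using map_dvd (algebraMap 𝒪 A) hp

theorem dvd_add_pow (A : Type*) [CommRing A] [Algebra 𝒪 A] (a b : A) :
    algebraMap 𝒪 A π ∣ (a + b) ^ resCard π - (a ^ resCard π + b ^ resCard π) := by
  obtain ⟨p, f, hpp, hq, hp, hf, -⟩ := resCard_eq π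
  obtain ⟨r, hr⟩ := exists_add_pow_prime_pow_eq hpp a b f
  rw [hq, hr, add_sub_cancel_left]
  have : algebraMap 𝒪 A π ∣ (p : A) := by simpa using map_dvd (algebraMap 𝒪 A) hp
  simp only [mul_assoc]
  exact this.mul_right _

theorem dvd_expand_sub_pow {σ : Type*} (P : MvPolynomial σ 𝒪) :
    algebraMap 𝒪 (MvPolynomial σ 𝒪) π ∣ MvPolynomial.expand (resCard π) P - P ^ resCard π := by
  induction P using MvPolynomial.induction_on with
  | C a =>
    obtain ⟨p, f, -, -, -, -, h⟩ := resCard_eq π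
    rw [MvPolynomial.expand_C, ← map_pow, ← map_sub]
    exact map_dvd MvPolynomial.C (h a)
  | add P Q hP hQ =>
    have := dvd_sub (dvd_add hP hQ) (dvd_add_pow π _ P Q)
    rw [map_add]
    convert this using 1
    ring
  | mul_X P s hP =>
    rw [map_mul, MvPolynomial.expand_X, mul_pow, ← sub_mul]
    exact hP.mul_right _

instance (σ : Type*) : PiTorsionFree π (MvPolynomial σ 𝒪) where
  eq_zero a h := by
    rcases mul_eq_zero.1 h with h | h
    · rw [MvPolynomial.algebraMap_eq, MvPolynomial.C_eq_zero] at h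
      exact absurd h hπ.out.ne_zero
    · exact h

/-- Dwork's lemma for polynomial rings. -/
theorem exists_poly {σ : Type*} (g : ℕ → MvPolynomial σ 𝒪)
    (hg : ∀ n, algebraMap 𝒪 (MvPolynomial σ 𝒪) π ^ (n + 1) ∣
      g (n + 1) - MvPolynomial.expand (resCard π) (g n)) :
    ∃ x : ℕ → MvPolynomial σ 𝒪, ∀ n, ghost π x n = g n :=
  exists_ghost_eq π _ (dvd_expand_sub_pow π) (dvd_resCard π _) g hg

theorem ghost_dvd_poly {σ : Type*} (x : ℕ → MvPolynomial σ 𝒪) (n : ℕ) :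
    algebraMap 𝒪 (MvPolynomial σ 𝒪) π ^ (n + 1) ∣
      ghost π x (n + 1) - MvPolynomial.expand (resCard π) (ghost π x n) :=
  ghost_dvd π _ (dvd_expand_sub_pow π) (dvd_resCard π _) x n

theorem exists_addPoly : ∃ S : ℕ → MvPolynomial (ℕ ⊕ ℕ) 𝒪, ∀ n, ghost π S n =
    ghost π (fun i => MvPolynomial.X (Sum.inl i)) n +
      ghost π (fun i => MvPolynomial.X (Sum.inr i)) n := by
  refine exists_poly π _ fun n => ?_
  rw [map_add, add_sub_add_comm]
  exact dvd_add (ghost_dvd_poly π _ n) (ghost_dvd_poly π _ n)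

theorem exists_mulPoly : ∃ S : ℕ → MvPolynomial (ℕ ⊕ ℕ) 𝒪, ∀ n, ghost π S n =
    ghost π (fun i => MvPolynomial.X (Sum.inl i)) n *
      ghost π (fun i => MvPolynomial.X (Sum.inr i)) n := by
  refine exists_poly π _ fun n => ?_
  have h1 := ghost_dvd_poly π (fun i => MvPolynomial.X (R := 𝒪) (Sum.inl (β := ℕ) i)) n
  have h2 := ghost_dvd_poly π (fun i => MvPolynomial.X (R := 𝒪) (Sum.inr (α := ℕ) i)) n
  rw [map_mul]
  convert dvd_add (h1.mul_right (ghost π (fun i => MvPolynomial.X (Sum.inr i)) (n + 1)))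
    (h2.mul_left (MvPolynomial.expand (resCard π)
      (ghost π (fun i => MvPolynomial.X (Sum.inl i)) n))) using 1
  ring

theorem exists_negPoly : ∃ S : ℕ → MvPolynomial ℕ 𝒪, ∀ n, ghost π S n =
    -ghost π (fun i => MvPolynomial.X i) n := by
  refine exists_poly π _ fun n => ?_
  rw [map_neg, ← neg_sub', dvd_neg]
  exact ghost_dvd_poly π _ n

/-- The Witt addition polynomials, characterised by
`w_n(S₀, S₁, …) = w_n(X₀, X₁, …) + w_n(Y₀, Y₁, …)`; `S_n` involves `X_i, Y_i` for `i ≤ n` only. -/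
noncomputable def addPoly : ℕ → MvPolynomial (ℕ ⊕ ℕ) 𝒪 := (exists_addPoly π).choose

/-- The Witt multiplication polynomials. -/
noncomputable def mulPoly : ℕ → MvPolynomial (ℕ ⊕ ℕ) 𝒪 := (exists_mulPoly π).choose

/-- The Witt negation polynomials. -/
noncomputable def negPoly : ℕ → MvPolynomial ℕ 𝒪 := (exists_negPoly π).choose

end StructurePolynomials

end RamifiedWitt

open RamifiedWitt

/-- The set `W_n(A) = A ^ (n + 1)` of `π`-typical Witt vectors of length `n + 1`. -/
@[ext]
structure WittVec {𝒪 : Type*} (π : 𝒪) (n : ℕ) (A : Type*) where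
  /-- The Witt coordinates. -/
  coeff : Fin (n + 1) → A

namespace WittVec

section Ring

variable {𝒪 : Type*} [CommRing 𝒪] {π : 𝒪} {n : ℕ} {A B : Type*} [CommRing A] [Algebra 𝒪 A]
  [CommRing B] [Algebra 𝒪 B]

/-- The coordinates, extended by zero. -/
def ext0 (x : WittVec π n A) (i : ℕ) : A := if h : i < n + 1 then x.coeff ⟨i, h⟩ else 0

/-- The first `n + 1` terms of a sequence, as a Witt vector. -/
def trunc (π : 𝒪) (n : ℕ) (x : ℕ → A) : WittVec π n A := ⟨fun i => x i⟩

theorem ext0_of_le (x : WittVec π n A) {i : ℕ} (h : i ≤ n) :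
    x.ext0 i = x.coeff ⟨i, Nat.lt_succ_of_le h⟩ := dif_pos _

theorem ext0_trunc (x : ℕ → A) {i : ℕ} (h : i ≤ n) : (trunc π n x).ext0 i = x i :=
  dif_pos (Nat.lt_succ_of_le h)

/-- The `i`-th ghost component `w_i`, for `i ≤ n`. -/
noncomputable def ghost (x : WittVec π n A) (i : ℕ) : A := RamifiedWitt.ghost π x.ext0 i

theorem ghost_trunc (x : ℕ → A) {i : ℕ} (h : i ≤ n) :
    (trunc π n x).ghost i = RamifiedWitt.ghost π x i :=
  ghost_congr π fun _ hj => ext0_trunc x (hj.trans h)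

theorem ghost_injective [PiTorsionFree π A] {x y : WittVec π n A}
    (h : ∀ i ≤ n, x.ghost i = y.ghost i) : x = y := by
  ext i
  have := eq_of_ghost_eq π h i (Nat.lt_succ_iff.1 i.2)
  rwa [ext0_of_le _ (Nat.lt_succ_iff.1 i.2), ext0_of_le _ (Nat.lt_succ_iff.1 i.2)] at this

/-- The map `W_n(A) → W_n(B)` that applies `f` to every coordinate. -/
def mapFun (f : A → B) (x : WittVec π n A) : WittVec π n B := ⟨fun i => f (x.coeff i)⟩

theorem ext0_mapFun (f : A →ₐ[𝒪] B) (x : WittVec π n A) (i : ℕ) :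
    (mapFun f x).ext0 i = f (x.ext0 i) := by
  unfold ext0
  split_ifs
  · rfl
  · exact (map_zero f).symm

theorem ghost_mapFun (f : A →ₐ[𝒪] B) (x : WittVec π n A) (i : ℕ) :
    (mapFun f x).ghost i = f (x.ghost i) := by
  unfold ghost
  rw [← ghost_map]
  congr 1
  ext j
  exact ext0_mapFun f x j

theorem mapFun_surjective {f : A → B} (hf : Function.Surjective f) :
    Function.Surjective (mapFun f : WittVec π n A → WittVec π n B) := fun y => by
  choose g hg using hf
  exact ⟨⟨fun i => g (y.coeff i)⟩, by ext i; exact hg _⟩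

variable [IsDomain 𝒪] [hπ : Fact (Prime π)] [hfin : Finite (𝒪 ⧸ Ideal.span {π})]

noncomputable instance : Add (WittVec π n A) :=
  ⟨fun x y => trunc π n fun i => MvPolynomial.aeval (Sum.elim x.ext0 y.ext0) (addPoly π i)⟩

noncomputable instance : Mul (WittVec π n A) :=
  ⟨fun x y => trunc π n fun i => MvPolynomial.aeval (Sum.elim x.ext0 y.ext0) (mulPoly π i)⟩

noncomputable instance : Neg (WittVec π n A) :=
  ⟨fun x => trunc π n fun i => MvPolynomial.aeval x.ext0 (negPoly π i)⟩

instance : Zero (WittVec π n A) := ⟨trunc π n fun _ => 0⟩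

instance : One (WittVec π n A) := ⟨trunc π n fun i => if i = 0 then 1 else 0⟩

theorem ghost_add (x y : WittVec π n A) {i : ℕ} (h : i ≤ n) :
    (x + y).ghost i = x.ghost i + y.ghost i := by
  change (trunc π n _).ghost i = _
  rw [ghost_trunc _ h, ghost_map, addPoly, (exists_addPoly π).choose_spec, map_add, ← ghost_map,
    ← ghost_map]
  simp [ghost]

theorem ghost_mul (x y : WittVec π n A) {i : ℕ} (h : i ≤ n) :
    (x * y).ghost i = x.ghost i * y.ghost i := by
  change (trunc π n _).ghost i = _
  rw [ghost_trunc _ h, ghost_map, mulPoly, (exists_mulPoly π).choose_spec, map_mul, ← ghost_map,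
    ← ghost_map]
  simp [ghost]

theorem ghost_neg (x : WittVec π n A) {i : ℕ} (h : i ≤ n) : (-x).ghost i = -x.ghost i := by
  change (trunc π n _).ghost i = _
  rw [ghost_trunc _ h, ghost_map, negPoly, (exists_negPoly π).choose_spec, map_neg, ← ghost_map]
  simp [ghost]

theorem resCard_pos : resCard π ≠ 0 := Nat.card_pos.ne'

theorem ghost_zero {i : ℕ} (h : i ≤ n) : (0 : WittVec π n A).ghost i = 0 := by
  change (trunc π n _).ghost i = _
  rw [ghost_trunc _ h]
  simp [RamifiedWitt.ghost, resCard_pos]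

theorem ghost_one {i : ℕ} (h : i ≤ n) : (1 : WittVec π n A).ghost i = 1 := by
  change (trunc π n _).ghost i = _
  rw [ghost_trunc _ h, RamifiedWitt.ghost, Finset.sum_range_succ']
  simp [resCard_pos]

theorem mapFun_trunc (f : A → B) (x : ℕ → A) :
    mapFun f (trunc π n x) = trunc π n (fun i => f (x i)) := rfl

theorem mapFun_add (f : A →ₐ[𝒪] B) (x y : WittVec π n A) :
    mapFun f (x + y) = mapFun f x + mapFun f y := by
  ext i
  change f (MvPolynomial.aeval _ (addPoly π i)) = MvPolynomial.aeval _ (addPoly π i)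
  rw [← AlgHom.comp_apply, MvPolynomial.comp_aeval]
  congr 2
  ext (j | j) <;> simp [ext0_mapFun]

theorem mapFun_mul (f : A →ₐ[𝒪] B) (x y : WittVec π n A) :
    mapFun f (x * y) = mapFun f x * mapFun f y := by
  ext i
  change f (MvPolynomial.aeval _ (mulPoly π i)) = MvPolynomial.aeval _ (mulPoly π i)
  rw [← AlgHom.comp_apply, MvPolynomial.comp_aeval]
  congr 2
  ext (j | j) <;> simp [ext0_mapFun]

theorem mapFun_neg (f : A →ₐ[𝒪] B) (x : WittVec π n A) : mapFun f (-x) = -mapFun f x := by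
  ext i
  change f (MvPolynomial.aeval _ (negPoly π i)) = MvPolynomial.aeval _ (negPoly π i)
  rw [← AlgHom.comp_apply, MvPolynomial.comp_aeval]
  congr 2
  ext j
  simp [ext0_mapFun]

theorem mapFun_zero (f : A →ₐ[𝒪] B) : mapFun f (0 : WittVec π n A) = 0 := by
  ext i
  exact map_zero f

theorem mapFun_one (f : A →ₐ[𝒪] B) : mapFun f (1 : WittVec π n A) = 1 := by
  ext i
  change f (if (i : ℕ) = 0 then 1 else 0) = if (i : ℕ) = 0 then 1 else 0
  split_ifs <;> simp

theorem exists_lift (π : 𝒪) (n : ℕ) (A : Type*) [CommRing A] [Algebra 𝒪 A] :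
    Function.Surjective (mapFun (MvPolynomial.aeval (R := 𝒪) (id : A → A)) :
      WittVec π n (MvPolynomial A 𝒪) → WittVec π n A) :=
  mapFun_surjective fun a => ⟨MvPolynomial.X a, by simp⟩

theorem add_assoc_aux (x y z : WittVec π n A) : x + y + z = x + (y + z) := by
  obtain ⟨x, rfl⟩ := exists_lift π n A x
  obtain ⟨y, rfl⟩ := exists_lift π n A y
  obtain ⟨z, rfl⟩ := exists_lift π n A z
  simp only [← mapFun_add]
  exact congrArg _ (ghost_injective fun i hi => by
    simp only [ghost_add _ _ hi, add_assoc])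

theorem zero_add_aux (x : WittVec π n A) : 0 + x = x := by
  obtain ⟨x, rfl⟩ := exists_lift π n A x
  rw [← mapFun_zero (MvPolynomial.aeval (R := 𝒪) (id : A → A))]
  simp only [← mapFun_add]
  exact congrArg _ (ghost_injective fun i hi => by
    simp only [ghost_add _ _ hi, ghost_zero hi, zero_add])

theorem neg_add_cancel_aux (x : WittVec π n A) : -x + x = 0 := by
  obtain ⟨x, rfl⟩ := exists_lift π n A x
  rw [← mapFun_zero (MvPolynomial.aeval (R := 𝒪) (id : A → A))]
  simp only [← mapFun_neg, ← mapFun_add]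
  exact congrArg _ (ghost_injective fun i hi => by
    simp only [ghost_neg _ hi, ghost_add _ _ hi, ghost_zero hi, neg_add_cancel])

theorem add_comm_aux (x y : WittVec π n A) : x + y = y + x := by
  obtain ⟨x, rfl⟩ := exists_lift π n A x
  obtain ⟨y, rfl⟩ := exists_lift π n A y
  simp only [← mapFun_add]
  exact congrArg _ (ghost_injective fun i hi => by
    simp only [ghost_add _ _ hi, add_comm])

theorem left_distrib_aux (x y z : WittVec π n A) : x * (y + z) = x * y + x * z := by
  obtain ⟨x, rfl⟩ := exists_lift π n A x
  obtain ⟨y, rfl⟩ := exists_lift π n A y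
  obtain ⟨z, rfl⟩ := exists_lift π n A z
  simp only [← mapFun_mul, ← mapFun_add]
  exact congrArg _ (ghost_injective fun i hi => by
    simp only [ghost_mul _ _ hi, ghost_add _ _ hi, mul_add])

theorem zero_mul_aux (x : WittVec π n A) : 0 * x = 0 := by
  obtain ⟨x, rfl⟩ := exists_lift π n A x
  rw [← mapFun_zero (MvPolynomial.aeval (R := 𝒪) (id : A → A))]
  simp only [← mapFun_mul]
  exact congrArg _ (ghost_injective fun i hi => by
    simp only [ghost_mul _ _ hi, ghost_zero hi, zero_mul])

theorem mul_assoc_aux (x y z : WittVec π n A) : x * y * z = x * (y * z) := by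
  obtain ⟨x, rfl⟩ := exists_lift π n A x
  obtain ⟨y, rfl⟩ := exists_lift π n A y
  obtain ⟨z, rfl⟩ := exists_lift π n A z
  simp only [← mapFun_mul]
  exact congrArg _ (ghost_injective fun i hi => by
    simp only [ghost_mul _ _ hi, mul_assoc])

theorem one_mul_aux (x : WittVec π n A) : 1 * x = x := by
  obtain ⟨x, rfl⟩ := exists_lift π n A x
  rw [← mapFun_one (MvPolynomial.aeval (R := 𝒪) (id : A → A))]
  simp only [← mapFun_mul]
  exact congrArg _ (ghost_injective fun i hi => by
    simp only [ghost_mul _ _ hi, ghost_one hi, one_mul])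

theorem mul_comm_aux (x y : WittVec π n A) : x * y = y * x := by
  obtain ⟨x, rfl⟩ := exists_lift π n A x
  obtain ⟨y, rfl⟩ := exists_lift π n A y
  simp only [← mapFun_mul]
  exact congrArg _ (ghost_injective fun i hi => by
    simp only [ghost_mul _ _ hi, mul_comm])

noncomputable instance : CommRing (WittVec π n A) where
  add_assoc := add_assoc_aux
  zero_add := zero_add_aux
  add_zero x := (add_comm_aux x 0).trans (zero_add_aux x)
  nsmul := nsmulRec
  zsmul := zsmulRec
  neg_add_cancel := neg_add_cancel_aux
  add_comm := add_comm_aux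
  left_distrib := left_distrib_aux
  right_distrib x y z := by
    rw [mul_comm_aux, left_distrib_aux, mul_comm_aux z x, mul_comm_aux z y]
  zero_mul := zero_mul_aux
  mul_zero x := (mul_comm_aux x 0).trans (zero_mul_aux x)
  mul_assoc := mul_assoc_aux
  one_mul := one_mul_aux
  mul_one x := (mul_comm_aux x 1).trans (one_mul_aux x)
  mul_comm := mul_comm_aux

/-- The ring homomorphism `W_n(f) : W_n(A) → W_n(B)`. -/
noncomputable def map (f : A →ₐ[𝒪] B) : WittVec π n A →+* WittVec π n B where
  toFun := mapFun f
  map_one' := mapFun_one f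
  map_mul' := mapFun_mul f
  map_zero' := mapFun_zero f
  map_add' := mapFun_add f

/-- The projection `w₀ : W_n(A) → A` to the first coordinate. -/
noncomputable def w0 : WittVec π n A →+* A where
  toFun x := x.coeff 0
  map_one' := rfl
  map_zero' := rfl
  map_add' x y := by
    have h := ghost_add x y (Nat.zero_le n)
    simpa [ghost, RamifiedWitt.ghost, ext0] using h
  map_mul' x y := by
    have h := ghost_mul x y (Nat.zero_le n)
    simpa [ghost, RamifiedWitt.ghost, ext0] using h

end Ring

end WittVec

/-! ## Lifts of Frobenius and the `R`-algebra structure on Witt vectors -/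

/-- A lift of the `q`-Frobenius on an `𝒪`-algebra `R`, where `q` is the cardinality of `𝒪 ⧸ (π)`:
an `𝒪`-algebra endomorphism `φ` of `R` with `φ r - r ^ q ∈ π R` for all `r`. -/
structure FrobLift {𝒪 : Type*} [CommRing 𝒪] (π : 𝒪) (R : Type*) [CommRing R] [Algebra 𝒪 R] where
  /-- The endomorphism. -/
  φ : R →ₐ[𝒪] R
  sub_pow_mem : ∀ r : R, φ r - r ^ resCard π ∈ Ideal.span {algebraMap 𝒪 R π}

namespace WittVec

variable {𝒪 : Type*} [CommRing 𝒪] {π : 𝒪} [IsDomain 𝒪] [hπ : Fact (Prime π)]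
  [hfin : Finite (𝒪 ⧸ Ideal.span {π})] {R : Type*} [CommRing R] [Algebra 𝒪 R] [PiTorsionFree π R]

theorem exists_exp (φ : FrobLift π R) (n : ℕ) (r : R) :
    ∃ x : WittVec π n R, ∀ i ≤ n, x.ghost i = φ.φ^[i] r := by
  obtain ⟨x, hx⟩ := exists_ghost_eq π φ.φ
    (fun a => Ideal.mem_span_singleton.1 (φ.sub_pow_mem a)) (dvd_resCard π R)
    (fun i => φ.φ^[i] r) (fun i => by simp only [Function.iterate_succ_apply', sub_self, dvd_zero])
  exact ⟨trunc π n x, fun i hi => by rw [ghost_trunc _ hi, hx]⟩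

/-- The Witt vector with ghost components `(r, φ r, …, φ ^ n r)`. -/
noncomputable def expFun (φ : FrobLift π R) (n : ℕ) (r : R) : WittVec π n R :=
  (exists_exp φ n r).choose

theorem ghost_expFun (φ : FrobLift π R) (n : ℕ) (r : R) {i : ℕ} (hi : i ≤ n) :
    (expFun φ n r).ghost i = φ.φ^[i] r := (exists_exp φ n r).choose_spec i hi

/-- The ring homomorphism `exp : R → W_n(R)` with ghost components `(id, φ, …, φ ^ n)`. -/
noncomputable def exp (φ : FrobLift π R) (n : ℕ) : R →+* WittVec π n R where
  toFun := expFun φ n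
  map_one' := ghost_injective fun i hi => by
    rw [ghost_expFun φ n _ hi, ghost_one hi, iterate_map_one]
  map_mul' x y := ghost_injective fun i hi => by
    rw [ghost_mul _ _ hi, ghost_expFun φ n _ hi, ghost_expFun φ n _ hi, ghost_expFun φ n _ hi,
      iterate_map_mul]
  map_zero' := ghost_injective fun i hi => by
    rw [ghost_expFun φ n _ hi, ghost_zero hi, iterate_map_zero]
  map_add' x y := ghost_injective fun i hi => by
    rw [ghost_add _ _ hi, ghost_expFun φ n _ hi, ghost_expFun φ n _ hi, ghost_expFun φ n _ hi,
      iterate_map_add]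

theorem exp_coeff_zero (φ : FrobLift π R) (n : ℕ) (r : R) : (exp φ n r).coeff 0 = r := by
  have h := ghost_expFun φ n r (Nat.zero_le n)
  change (expFun φ n r).coeff 0 = r
  simpa [ghost, RamifiedWitt.ghost, ext0] using h

theorem ghost_exp (φ : FrobLift π R) (n : ℕ) (r : R) {i : ℕ} (hi : i ≤ n) :
    (exp φ n r).ghost i = φ.φ^[i] r := ghost_expFun φ n r hi

theorem dvd_exp_coeff (φ : FrobLift π R) (n N : ℕ) : ∀ (i : ℕ) (hi : i ≤ n),
    algebraMap 𝒪 R π ^ (N + (n - i)) ∣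
      (exp φ n (algebraMap 𝒪 R π ^ (N + n))).coeff ⟨i, Nat.lt_succ_of_le hi⟩ := by
  intro i
  induction i using Nat.strong_induction_on with
  | _ i ih =>
    intro hi
    have h := ghost_exp φ n (algebraMap 𝒪 R π ^ (N + n)) hi
    rw [iterate_map_pow] at h
    have hf : φ.φ^[i] (algebraMap 𝒪 R π) = algebraMap 𝒪 R π :=
      Function.iterate_fixed (φ.φ.commutes π) i
    rw [hf, ghost, RamifiedWitt.ghost, Finset.sum_range_succ, Nat.sub_self, pow_zero, pow_one,
      ext0_of_le _ hi] at h
    have h1 : algebraMap 𝒪 R π ^ (N + n) ∣ ∑ j ∈ Finset.range i, algebraMap 𝒪 R π ^ j *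
        (exp φ n (algebraMap 𝒪 R π ^ (N + n))).ext0 j ^ resCard π ^ (i - j) := by
      refine Finset.dvd_sum fun j hj => ?_
      have hj' := Finset.mem_range.1 hj
      rw [ext0_of_le _ (hj'.le.trans hi)]
      have e : algebraMap 𝒪 R π ^ (N + n) =
          algebraMap 𝒪 R π ^ j * algebraMap 𝒪 R π ^ (N + (n - j)) := by
        rw [← pow_add]
        congr 1
        omega
      refine e.dvd.trans (mul_dvd_mul_left _ ((ih j hj' (hj'.le.trans hi)).trans ?_))
      exact dvd_pow_self _ (pow_ne_zero _ resCard_pos)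
    have h2 := (dvd_add_right h1).1 (Dvd.intro_left 1 (by rw [one_mul, h]))
    obtain ⟨c, hc⟩ := h2
    refine ⟨c, PiTorsionFree.pow_mul_cancel π i ?_⟩
    rw [hc, ← mul_assoc, ← pow_add, show i + (N + (n - i)) = N + n by omega]

variable {C : Type*} [CommRing C] [Algebra 𝒪 C] [Algebra R C] [IsScalarTower 𝒪 R C]

/-- The `R`-algebra structure `R → W_n(R) → W_n(C)` of the Witt vectors of an `R`-algebra `C`. -/
@[reducible]
noncomputable def algebra (φ : FrobLift π R) (n : ℕ) (C : Type*) [CommRing C] [Algebra 𝒪 C]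
    [Algebra R C] [IsScalarTower 𝒪 R C] : Algebra R (WittVec π n C) :=
  ((map (IsScalarTower.toAlgHom 𝒪 R C)).comp (exp φ n)).toAlgebra

theorem isNilpotent (φ : FrobLift π R) (n : ℕ)
    (h : IsNilpotent (algebraMap R C (algebraMap 𝒪 R π))) :
    IsNilpotent (map (IsScalarTower.toAlgHom 𝒪 R C) (exp φ n (algebraMap 𝒪 R π))) := by
  obtain ⟨N, hN⟩ := h
  refine ⟨N + n, ?_⟩
  rw [← map_pow, ← map_pow]
  ext i
  obtain ⟨c, hc⟩ := dvd_exp_coeff φ n N i (Nat.lt_succ_iff.1 i.2)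
  change algebraMap R C (coeff _ _) = 0
  rw [hc, map_mul, map_pow, pow_add, hN, zero_mul, zero_mul]

end WittVec

/-! ## Formal schemes over `R` as sheaves on `R`-algebras on which `ϖ` is nilpotent -/

/-- The category of `R`-algebras on which `ϖ` is nilpotent. -/
abbrev Nilp {R : Type u} [CommRing R] (ϖ : R) : Type (u + 1) :=
  ObjectProperty.FullSubcategory fun C : CommAlgCat.{u} R => IsNilpotent (algebraMap R C ϖ)

section FormalSchemes

variable {R : Type u} [CommRing R] {ϖ : R}

namespace Nilp

/-- The localization `C[1/f]`. -/
noncomputable def away (C : Nilp ϖ) (f : C.obj) : Nilp ϖ where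
  obj := CommAlgCat.of R (Localization.Away f)
  property := by
    have h := C.property.map (algebraMap C.obj (Localization.Away f))
    rwa [← IsScalarTower.algebraMap_apply] at h

/-- The localization map `C → C[1/f]`. -/
noncomputable def toAway (C : Nilp ϖ) (f : C.obj) : C ⟶ C.away f :=
  ObjectProperty.homMk (CommAlgCat.ofHom (IsScalarTower.toAlgHom R C.obj (Localization.Away f)))

end Nilp

/-- `F` is a sheaf for the Zariski topology on the opposite of `Nilp ϖ`: for all elements
`f ∈ s` of `C` that generate the unit ideal, compatible sections over the `C[1/f]` glue uniquely. -/
def IsZariskiSheaf (F : Nilp ϖ ⥤ Type u) : Prop :=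
  ∀ (C : Nilp ϖ) (s : Set C.obj), Ideal.span s = ⊤ →
    ∀ x : ∀ f : s, F.obj (C.away f.1),
      (∀ (f g : s) (D : Nilp ϖ) (a : C.away f.1 ⟶ D) (b : C.away g.1 ⟶ D),
        C.toAway f.1 ≫ a = C.toAway g.1 ≫ b → F.map a (x f) = F.map b (x g)) →
      ∃! y : F.obj C, ∀ f : s, F.map (C.toAway f.1) y = x f

/-- The formal spectrum of `A` with ideal of definition `I`:
`Spf(A)(C) = colim_k Hom_R(A / I ^ k, C)`, the set of `R`-algebra homomorphisms `A → C` that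
vanish on some power of `I`. -/
def Spf (ϖ : R) (A : Type u) [CommRing A] [Algebra R A] (I : Ideal A) : Nilp ϖ ⥤ Type u where
  obj C := {f : A →ₐ[R] C.obj // ∃ k : ℕ, I ^ k ≤ RingHom.ker f}
  map g := ↾ fun f => ⟨g.hom.hom.comp f.1, f.2.imp fun k hk a ha => by
    have h : f.1 a = 0 := hk ha
    change g.hom.hom (f.1 a) = 0
    rw [h, map_zero]⟩

/-- A subfunctor `U` of `F` is open if for every point `x` of `F` with values in `C`, the locus
where `x` lies in `U` is an open subset `Spec C ∖ V(J)` of `Spec C`. -/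
def IsOpenSubfunctor {F : Nilp ϖ ⥤ Type u} (U : Subfunctor F) : Prop :=
  ∀ (C : Nilp ϖ) (x : F.obj C), ∃ J : Ideal C.obj, ∀ (D : Nilp ϖ) (g : C ⟶ D),
    F.map g x ∈ U.obj D ↔ J.map g.hom.hom = ⊤

/-- `F` is covered, locally for the Zariski topology, by open subfunctors with property `P`. -/
def HasOpenCover (P : (Nilp ϖ ⥤ Type u) → Prop) (F : Nilp ϖ ⥤ Type u) : Prop :=
  ∃ 𝒰 : Set (Subfunctor F), (∀ U ∈ 𝒰, IsOpenSubfunctor U ∧ P U.toFunctor) ∧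
    ∀ (C : Nilp ϖ) (x : F.obj C), ∃ s : Set C.obj, Ideal.span s = ⊤ ∧
      ∀ f ∈ s, ∃ U ∈ 𝒰, F.map (C.toAway f) x ∈ U.obj (C.away f)

/-- `F` is isomorphic to `Spf(A)` for an adic `R`-algebra `A` (complete and separated) that has
an ideal of definition containing `ϖ`. -/
def IsFormalAffine (F : Nilp ϖ ⥤ Type u) : Prop :=
  ∃ (A : CommAlgCat.{u} R) (I : Ideal A), IsAdicComplete I A ∧ algebraMap R A ϖ ∈ I ∧
    Nonempty (F ≅ Spf ϖ A I)

open scoped TensorProduct in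
/-- `F` is isomorphic to `Spf(A)` for a `ϖ`-adically complete and separated `R`-algebra `A` with
its `ϖ`-adic topology, such that `A / ϖ ^ m` is a smooth `R / ϖ ^ m`-algebra for all `m`. -/
def IsSmoothFormalAffine (F : Nilp ϖ ⥤ Type u) : Prop :=
  ∃ A : CommAlgCat.{u} R, IsAdicComplete (Ideal.span {algebraMap R A ϖ}) A ∧
    (∀ m : ℕ, Algebra.Smooth (R ⧸ Ideal.span {ϖ ^ m}) ((R ⧸ Ideal.span {ϖ ^ m}) ⊗[R] A)) ∧
    Nonempty (F ≅ Spf ϖ A (Ideal.span {algebraMap R A ϖ}))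

/-- Formal schemes over `R`: Zariski sheaves with an open cover by formal spectra. -/
def IsFormalScheme (F : Nilp ϖ ⥤ Type u) : Prop :=
  IsZariskiSheaf F ∧ HasOpenCover IsFormalAffine F

/-- Smooth formal schemes over `R`. -/
def IsSmoothFormalScheme (F : Nilp ϖ ⥤ Type u) : Prop :=
  IsFormalScheme F ∧ HasOpenCover IsSmoothFormalAffine F

/-- Smooth formal group schemes over `R`: functors to groups whose underlying functor to sets is
a smooth formal scheme over `R`. -/
def IsSmoothFormalGroupScheme (G : Nilp ϖ ⥤ GrpCat.{u}) : Prop :=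
  IsSmoothFormalScheme (G ⋙ forget GrpCat.{u})

/-- The kernel of a homomorphism of functors to groups. -/
def groupKernel {G H : Nilp ϖ ⥤ GrpCat.{u}} (α : G ⟶ H) : Nilp ϖ ⥤ GrpCat.{u} where
  obj C := GrpCat.of (α.app C).hom.ker
  map {C D} f := GrpCat.ofHom
    (((G.map f).hom.comp (α.app C).hom.ker.subtype).codRestrict (α.app D).hom.ker fun x => by
      have h := ConcreteCategory.congr_hom (α.naturality f) x.1
      have hx : α.app C x.1 = 1 := x.2
      have h' : α.app D (G.map f x.1) = H.map f (α.app C x.1) := h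
      rw [hx, map_one] at h'
      exact h')

end FormalSchemes

/-! ## Arithmetic jets -/

section Jets

variable {𝒪 : Type*} [CommRing 𝒪] {π : 𝒪} [IsDomain 𝒪] [hπ : Fact (Prime π)]
  [hfin : Finite (𝒪 ⧸ Ideal.span {π})] {R : Type u} [CommRing R] [Algebra 𝒪 R]
  [PiTorsionFree π R]

/-- An `R`-algebra is an `𝒪`-algebra by restriction of scalars. -/
@[reducible]
def restrictAlgebra (𝒪 : Type*) [CommRing 𝒪] {R : Type u} [CommRing R] [Algebra 𝒪 R]
    (C : CommAlgCat.{u} R) : Algebra 𝒪 C := Algebra.compHom C (algebraMap 𝒪 R)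

attribute [local instance] restrictAlgebra

theorem restrictAlgebra_tower (C : CommAlgCat.{u} R) : IsScalarTower 𝒪 R C :=
  IsScalarTower.of_algebraMap_eq' rfl

attribute [local instance] restrictAlgebra_tower

/-- The `R`-algebra `W_n(C)`, for an `R`-algebra `C` on which `π` is nilpotent. -/
noncomputable def wittObj (φ : FrobLift π R) (n : ℕ) (C : Nilp (algebraMap 𝒪 R π)) :
    Nilp (algebraMap 𝒪 R π) where
  obj := @CommAlgCat.of R _ (WittVec π n C.obj) _ (WittVec.algebra φ n C.obj)
  property := WittVec.isNilpotent φ n C.property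

/-- The functor `W_n` on `R`-algebras on which `π` is nilpotent. -/
noncomputable def wittFunctor (φ : FrobLift π R) (n : ℕ) :
    Nilp (algebraMap 𝒪 R π) ⥤ Nilp (algebraMap 𝒪 R π) where
  obj := wittObj φ n
  map {C D} f := ObjectProperty.homMk (ConcreteCategory.ofHom (C := CommAlgCat R)
    (X := (wittObj φ n C).obj) (Y := (wittObj φ n D).obj)
    { WittVec.map (f.hom.hom.restrictScalars 𝒪) with
      commutes' := fun r => WittVec.ext (funext fun i => f.hom.hom.commutes _) })

/-- The natural projection `w₀ : W_n(C) → C`. -/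
noncomputable def wittProj (φ : FrobLift π R) (n : ℕ) :
    wittFunctor φ n ⟶ 𝟭 (Nilp (algebraMap 𝒪 R π)) where
  app C := ObjectProperty.homMk (ConcreteCategory.ofHom (C := CommAlgCat R)
    (X := (wittObj φ n C).obj) (Y := C.obj)
    { WittVec.w0 with
      commutes' := fun r => congrArg (algebraMap R C.obj) (WittVec.exp_coeff_zero φ n r) })

/-- The `n`-th jet `J^n G` of a functor to groups: `J^n G (C) = G (W_n(C))`. -/
noncomputable def jet (φ : FrobLift π R) (n : ℕ) (G : Nilp (algebraMap 𝒪 R π) ⥤ GrpCat.{u}) :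
    Nilp (algebraMap 𝒪 R π) ⥤ GrpCat.{u} :=
  wittFunctor φ n ⋙ G

/-- The natural morphism `u : J^n G → G`. -/
noncomputable def jetProj (φ : FrobLift π R) (n : ℕ)
    (G : Nilp (algebraMap 𝒪 R π) ⥤ GrpCat.{u}) : jet φ n G ⟶ G where
  app C := G.map ((wittProj φ n).app C)
  naturality C D f := by
    have h := (wittProj φ n).naturality f
    change G.map _ ≫ G.map _ = G.map _ ≫ G.map _
    rw [← G.map_comp, ← G.map_comp]
    exact congrArg G.map h

/-- `N^n G`, the kernel of `u : J^n G → G`. -/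
noncomputable def jetKernel (φ : FrobLift π R) (n : ℕ)
    (G : Nilp (algebraMap 𝒪 R π) ⥤ GrpCat.{u}) : Nilp (algebraMap 𝒪 R π) ⥤ GrpCat.{u} :=
  groupKernel (jetProj φ n G)

end Jets

/-! ## The base ring -/

section LocalField

variable {p : ℕ} [Fact p.Prime] {K : Type*} [Field K] [Algebra ℚ_[p] K]
  [FiniteDimensional ℚ_[p] K] [Algebra ℤ_[p] K] [IsScalarTower ℤ_[p] ℚ_[p] K]

/-- The residue field of the ring of integers of a finite extension of `ℚ_p` is finite. -/
instance finite_residue (π : integralClosure ℤ_[p] K) [hπ : Fact (Prime π)] :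
    Finite (integralClosure ℤ_[p] K ⧸ Ideal.span {π}) := by
  have hprime : (Ideal.span {π}).IsPrime := (Ideal.span_singleton_prime hπ.out.ne_zero).2 hπ.out
  have hfinite : Module.Finite ℤ_[p] (integralClosure ℤ_[p] K) :=
    IsIntegralClosure.finite ℤ_[p] ℚ_[p] K (integralClosure ℤ_[p] K)
  have hne : (Ideal.span {π}).comap (algebraMap ℤ_[p] (integralClosure ℤ_[p] K)) ≠ ⊥ :=
    Ideal.comap_ne_bot_of_integral_mem hπ.out.ne_zero (Ideal.mem_span_singleton_self π)
      (Algebra.IsIntegral.isIntegral π)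
  have hmax : (Ideal.span {π}).comap (algebraMap ℤ_[p] (integralClosure ℤ_[p] K)) =
      IsLocalRing.maximalIdeal ℤ_[p] :=
    IsLocalRing.eq_maximalIdeal (Ring.DimensionLEOne.maximalOfPrime hne inferInstance)
  have hres : Finite (ℤ_[p] ⧸ (Ideal.span {π}).comap
      (algebraMap ℤ_[p] (integralClosure ℤ_[p] K))) := by
    rw [hmax]
    exact Finite.of_equiv (ZMod p) PadicInt.residueField.symm.toEquiv
  have hfin' : Module.Finite ℤ_[p] (integralClosure ℤ_[p] K ⧸ Ideal.span {π}) := inferInstance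
  let _ : Algebra (ℤ_[p] ⧸ (Ideal.span {π}).comap (algebraMap ℤ_[p] (integralClosure ℤ_[p] K)))
      (integralClosure ℤ_[p] K ⧸ Ideal.span {π}) :=
    Ideal.Quotient.algebraQuotientOfLEComap le_rfl
  have htower : IsScalarTower ℤ_[p]
      (ℤ_[p] ⧸ (Ideal.span {π}).comap (algebraMap ℤ_[p] (integralClosure ℤ_[p] K)))
      (integralClosure ℤ_[p] K ⧸ Ideal.span {π}) := IsScalarTower.of_algebraMap_eq' rfl
  have := Module.Finite.of_restrictScalars_finite ℤ_[p]
    (ℤ_[p] ⧸ (Ideal.span {π}).comap (algebraMap ℤ_[p] (integralClosure ℤ_[p] K)))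
    (integralClosure ℤ_[p] K ⧸ Ideal.span {π})
  exact Module.finite_of_finite
    (ℤ_[p] ⧸ (Ideal.span {π}).comap (algebraMap ℤ_[p] (integralClosure ℤ_[p] K)))

end LocalField

/-!
The map `W_1(W_m(C)) → W_{m+1}(C)` sending ghost components `(a, b)` to `(a₀, b₀, …, b_m)`
identifies `W_1(W_m(C))` with the fibre product of `W_{m+1}(C)` and `W_m(C)` over `C`, because
`(s, x) ∈ W_1(W_m(C))` goes to `σ(s) + V(x)`, where `σ(s)` depends on `s` only and `V` is the
Verschiebung. As `V(x) V(y) = π V(x y)`, the kernel of `W_{m+1}(C) → C` is a nil ideal. Along such a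
nil thickening the spectra do not change as topological spaces, so homomorphisms out of an adic
ring, and by gluing the points of any formal scheme `G`, take the square of rings to a fibre square.
Hence `N^{m+1} G`, the kernel of `G(W_{m+1}(C)) → G(C)`, agrees with the kernel of the parallel map
`G(W_1(W_m(C))) → G(W_m(C))`, which is `J^m (N^1 G)`.
-/

section FibreSquares

/-- A commutative square of maps (`c ∘ a = d ∘ b`) that identifies `P` with the fibre product
`W ×_C S`: the elementwise form of a pullback square of sets. -/
structure IsFibreSquare {P W S C : Type*} (a : P → W) (b : P → S) (c : W → C) (d : S → C) :
    Prop where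
  comm : ∀ p, c (a p) = d (b p)
  existsUnique : ∀ w s, c w = d s → ∃! p, a p = w ∧ b p = s

namespace IsFibreSquare

variable {P W S C : Type*}

theorem eq_of_eq {a : P → W} {b : P → S} {c : W → C} {d : S → C} (h : IsFibreSquare a b c d)
    {p p' : P} (ha : a p = a p') (hb : b p = b p') : p = p' :=
  (h.existsUnique _ _ (h.comm p')).unique ⟨ha, hb⟩ ⟨rfl, rfl⟩

theorem of_equiv {P' W' S' C' : Type*} {a : P → W} {b : P → S} {c : W → C} {d : S → C}
    {a' : P' → W'} {b' : P' → S'} {c' : W' → C'} {d' : S' → C'} (h : IsFibreSquare a' b' c' d')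
    (eP : P ≃ P') (eW : W ≃ W') (eS : S ≃ S') (eC : C ≃ C')
    (ha : ∀ p, eW (a p) = a' (eP p)) (hb : ∀ p, eS (b p) = b' (eP p))
    (hc : ∀ w, eC (c w) = c' (eW w)) (hd : ∀ s, eC (d s) = d' (eS s)) :
    IsFibreSquare a b c d where
  comm p := eC.injective (by rw [hc, hd, ha, hb, h.comm])
  existsUnique w s hws := by
    refine (eP.existsUnique_congr fun {p} => ?_).2
      (h.existsUnique (eW w) (eS s) (by rw [← hc, ← hd, hws]))
    rw [← ha, ← hb, eW.apply_eq_iff_eq, eS.apply_eq_iff_eq]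

variable [CommRing P] [CommRing W] [CommRing S] [CommRing C]
  {a : P →+* W} {b : P →+* S} {c : W →+* C} {d : S →+* C}

theorem of_ringHom (comm : ∀ p, c (a p) = d (b p)) (eq_zero : ∀ p, a p = 0 → b p = 0 → p = 0)
    (exists_eq : ∀ w s, c w = d s → ∃ p, a p = w ∧ b p = s) : IsFibreSquare a b c d where
  comm := comm
  existsUnique w s hws := by
    obtain ⟨p, rfl, rfl⟩ := exists_eq w s hws
    refine ⟨p, ⟨rfl, rfl⟩, fun p' ⟨ha, hb⟩ => sub_eq_zero.1 (eq_zero _ ?_ ?_)⟩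
    · rw [map_sub, ha, sub_self]
    · rw [map_sub, hb, sub_self]

end IsFibreSquare

/-- A surjective ring homomorphism whose kernel consists of nilpotent elements: a closed immersion
of affine schemes that is a homeomorphism. -/
structure IsNilThickening {A B : Type*} [CommRing A] [CommRing B] (f : A →+* B) : Prop where
  surjective : Function.Surjective f
  ker_le_nilradical : RingHom.ker f ≤ nilradical A

namespace IsNilThickening

variable {A B : Type*} [CommRing A] [CommRing B] {f : A →+* B}

theorem eq_top_of_map_eq_top (hf : IsNilThickening f) {J : Ideal A} (hJ : J.map f = ⊤) :
    J = ⊤ := by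
  obtain ⟨j, hj, hj1⟩ :=
    (Ideal.mem_map_iff_of_surjective f hf.surjective).1 ((Ideal.eq_top_iff_one _).1 hJ)
  have hnil : IsNilpotent (1 - j) :=
    hf.ker_le_nilradical (RingHom.mem_ker.2 (by rw [map_sub, hj1, map_one, sub_self]))
  refine J.eq_top_of_isUnit_mem hj ?_
  simpa only [sub_sub_cancel] using hnil.isUnit_one_sub

theorem of_isFibreSquare {P W S C : Type*} [CommRing P] [CommRing W] [CommRing S] [CommRing C]
    {a : P →+* W} {b : P →+* S} {c : W →+* C} {d : S →+* C} (hc : IsNilThickening c)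
    (h : IsFibreSquare a b c d) : IsNilThickening b where
  surjective s := by
    obtain ⟨w, hw⟩ := hc.surjective (d s)
    obtain ⟨p, -, hp⟩ := (h.existsUnique w s hw).exists
    exact ⟨p, hp⟩
  ker_le_nilradical p (hp : b p = 0) := by
    obtain ⟨k, hk⟩ : IsNilpotent (a p) :=
      hc.ker_le_nilradical (RingHom.mem_ker.2 (by rw [h.comm, hp, map_zero]))
    refine ⟨k + 1, h.eq_of_eq ?_ ?_⟩
    · rw [map_pow, pow_succ, hk, zero_mul, map_zero]
    · rw [map_pow, hp, zero_pow k.succ_ne_zero, map_zero]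

theorem of_away (hf : IsNilThickening f) (r : A) {A' B' : Type*} [CommRing A'] [CommRing B']
    [Algebra A A'] [Algebra B B'] [IsLocalization.Away r A'] [IsLocalization.Away (f r) B']
    {f' : A' →+* B'} (hf' : ∀ x, f' (algebraMap A A' x) = algebraMap B B' (f x)) :
    IsNilThickening f' := by
  have hmap : (Submonoid.powers r).map f = Submonoid.powers (f r) := Submonoid.map_powers f r
  have hB' : IsLocalization ((Submonoid.powers r).map f) B' := by rw [hmap]; infer_instance
  have hf'_eq : f' = IsLocalization.map B' f (hmap ▸ (Submonoid.powers r).le_comap_map) :=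
    IsLocalization.ringHom_ext (Submonoid.powers r) (RingHom.ext fun x => by simp [hf'])
  constructor
  · rw [hf'_eq]
    exact IsLocalization.map_surjective_of_surjective _ _ _ hf.surjective
  · rw [hf'_eq, IsLocalization.ker_map B' f hmap, Ideal.map_le_iff_le_comap]
    exact fun x hx => (mem_nilradical.1 (hf.ker_le_nilradical hx)).map (algebraMap A A')

end IsNilThickening

namespace IsFibreSquare

variable {P W S C P' W' S' C' : Type*} [CommRing P] [CommRing W] [CommRing S] [CommRing C]
  [CommRing P'] [CommRing W'] [CommRing S'] [CommRing C']
  [Algebra P P'] [Algebra W W'] [Algebra S S'] [Algebra C C']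
  {a : P →+* W} {b : P →+* S} {c : W →+* C} {d : S →+* C}
  {a' : P' →+* W'} {b' : P' →+* S'} {c' : W' →+* C'} {d' : S' →+* C'}

theorem eq_zero_of_away (h : IsFibreSquare a b c d) (f : P) [IsLocalization.Away f P']
    [IsLocalization.Away (a f) W'] [IsLocalization.Away (b f) S']
    (ha : ∀ x, a' (algebraMap P P' x) = algebraMap W W' (a x))
    (hb : ∀ x, b' (algebraMap P P' x) = algebraMap S S' (b x))
    {p : P'} (hap : a' p = 0) (hbp : b' p = 0) : p = 0 := by
  obtain ⟨n, p₀, hp⟩ := IsLocalization.Away.surj f p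
  obtain ⟨i, hi⟩ : ∃ i, a f ^ i * a p₀ = a f ^ i * 0 :=
    IsLocalization.Away.exists_of_eq (S := W') _ (by rw [← ha, ← hp, map_mul, hap]; simp)
  obtain ⟨j, hj⟩ : ∃ j, b f ^ j * b p₀ = b f ^ j * 0 :=
    IsLocalization.Away.exists_of_eq (S := S') _ (by rw [← hb, ← hp, map_mul, hbp]; simp)
  have hp₀ : f ^ (i + j) * p₀ = 0 := by
    refine h.eq_of_eq ?_ ?_
    · rw [map_mul, map_pow, pow_add, mul_right_comm, hi, mul_zero, zero_mul, map_zero]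
    · rw [map_mul, map_pow, pow_add, mul_assoc, hj, mul_zero, mul_zero, map_zero]
  have hu : IsUnit (algebraMap P P' f ^ (i + j + n)) :=
    (IsLocalization.Away.algebraMap_isUnit f).pow _
  rw [← hu.mul_right_eq_zero, pow_add, mul_assoc, mul_comm _ p, hp, ← map_pow, ← map_mul, hp₀,
    map_zero]

theorem exists_eq_of_away (h : IsFibreSquare a b c d) (f : P) [IsLocalization.Away f P']
    [IsLocalization.Away (a f) W'] [IsLocalization.Away (b f) S']
    [IsLocalization.Away (c (a f)) C']
    (ha : ∀ x, a' (algebraMap P P' x) = algebraMap W W' (a x))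
    (hb : ∀ x, b' (algebraMap P P' x) = algebraMap S S' (b x))
    (hc : ∀ x, c' (algebraMap W W' x) = algebraMap C C' (c x))
    (hd : ∀ x, d' (algebraMap S S' x) = algebraMap C C' (d x))
    {w : W'} {s : S'} (hws : c' w = d' s) : ∃ p, a' p = w ∧ b' p = s := by
  obtain ⟨k, w₀, hw⟩ := IsLocalization.Away.surj (a f) w
  obtain ⟨l, s₀, hs⟩ := IsLocalization.Away.surj (b f) s
  have hC : algebraMap C C' (c (w₀ * a f ^ l)) = algebraMap C C' (d (s₀ * b f ^ k)) := by
    rw [← hc, ← hd, map_mul, map_mul (algebraMap S S'), ← hw, ← hs]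
    simp only [map_mul, map_pow, hws, hc, hd, h.comm]
    ring
  obtain ⟨j, hj⟩ := IsLocalization.Away.exists_of_eq (c (a f)) hC
  obtain ⟨p, ⟨hap, hbp⟩, -⟩ := h.existsUnique (a f ^ j * (w₀ * a f ^ l))
    (b f ^ j * (s₀ * b f ^ k)) (by
      rw [map_mul c, map_pow c, hj, map_mul d (b f ^ j), map_pow d, h.comm])
  have hu : IsUnit (algebraMap P P' f ^ (j + k + l)) :=
    (IsLocalization.Away.algebraMap_isUnit f).pow _
  obtain ⟨p', hp'⟩ := hu.dvd (a := algebraMap P P' p)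
  refine ⟨p', (hu.map a').mul_left_cancel ?_, (hu.map b').mul_left_cancel ?_⟩
  · rw [← map_mul, ← hp', ha, hap, map_mul, map_mul, ← hw]
    simp only [map_pow, ha]
    ring
  · rw [← map_mul, ← hp', hb, hbp, map_mul, map_mul, ← hs]
    simp only [map_pow, hb]
    ring

theorem of_away (h : IsFibreSquare a b c d) (f : P) [IsLocalization.Away f P']
    [IsLocalization.Away (a f) W'] [IsLocalization.Away (b f) S']
    [IsLocalization.Away (c (a f)) C']
    (ha : ∀ x, a' (algebraMap P P' x) = algebraMap W W' (a x))
    (hb : ∀ x, b' (algebraMap P P' x) = algebraMap S S' (b x))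
    (hc : ∀ x, c' (algebraMap W W' x) = algebraMap C C' (c x))
    (hd : ∀ x, d' (algebraMap S S' x) = algebraMap C C' (d x)) : IsFibreSquare a' b' c' d' := by
  have comm : c'.comp a' = d'.comp b' :=
    IsLocalization.ringHom_ext (Submonoid.powers f) (RingHom.ext fun x => by
      simp only [RingHom.comp_apply, ha, hb, hc, hd, h.comm])
  exact .of_ringHom (RingHom.congr_fun comm) (fun _ => h.eq_zero_of_away f ha hb)
    (fun _ _ => h.exists_eq_of_away f ha hb hc hd)

end IsFibreSquare

end FibreSquares

namespace Nilp

variable {R : Type u} [CommRing R] {ϖ : R} {C D : Nilp ϖ}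

/-- The ring homomorphism underlying a morphism of `Nilp ϖ`. -/
abbrev ringHom (f : C ⟶ D) : C.obj →+* D.obj := f.hom.hom

theorem hom_ext {f g : C ⟶ D} (h : ∀ x, ringHom f x = ringHom g x) : f = g :=
  ObjectProperty.hom_ext _ (CommAlgCat.hom_ext (AlgHom.ext h))

noncomputable instance (f : C.obj) : Algebra C.obj (C.away f).obj :=
  inferInstanceAs (Algebra C.obj (Localization.Away f))

instance isLocalization_away (f : C.obj) : IsLocalization.Away f (C.away f).obj :=
  inferInstanceAs (IsLocalization.Away f (Localization.Away f))

theorem isUnit_toAway_of_dvd {f h : C.obj} (hf : f ∣ h) : IsUnit (ringHom (C.toAway h) f) :=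
  IsLocalization.Away.isUnit_of_dvd (S := (C.away h).obj) h hf

/-- The homomorphism `C[1/f] → D` extending a homomorphism `g : C → D` that inverts `f`. -/
noncomputable def awayLift (g : C ⟶ D) {f : C.obj} (hf : IsUnit (ringHom g f)) : C.away f ⟶ D :=
  ObjectProperty.homMk (CommAlgCat.ofHom
    (IsLocalization.Away.liftAlgHom (S := Localization.Away f) (A := R) f (f := g.hom.hom) hf))

theorem toAway_awayLift (g : C ⟶ D) {f : C.obj} (hf : IsUnit (ringHom g f)) :
    C.toAway f ≫ awayLift g hf = g :=
  hom_ext fun x => IsLocalization.Away.lift_eq (S := Localization.Away f) f hf x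

theorem away_hom_ext {f : C.obj} {g h : C.away f ⟶ D}
    (hgh : C.toAway f ≫ g = C.toAway f ≫ h) : g = h := by
  have key : ringHom g = ringHom h :=
    IsLocalization.ringHom_ext (Submonoid.powers f) (RingHom.ext fun x =>
      DFunLike.congr_fun (congrArg ringHom hgh) x)
  exact hom_ext (RingHom.congr_fun key)

/-- The homomorphism `C[1/f] → D[1/h]` induced by `g : C → D` when `g f` divides `h`. -/
noncomputable def awayMap (g : C ⟶ D) {f : C.obj} {h : D.obj} (hd : ringHom g f ∣ h) :
    C.away f ⟶ D.away h :=
  awayLift (g ≫ D.toAway h) (isUnit_toAway_of_dvd hd)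

theorem toAway_awayMap (g : C ⟶ D) {f : C.obj} {h : D.obj} (hd : ringHom g f ∣ h) :
    C.toAway f ≫ awayMap g hd = g ≫ D.toAway h :=
  toAway_awayLift _ _

theorem awayMap_algebraMap (g : C ⟶ D) {f : C.obj} {h : D.obj} (hd : ringHom g f ∣ h)
    (x : C.obj) : ringHom (awayMap g hd) (algebraMap C.obj (C.away f).obj x) =
      algebraMap D.obj (D.away h).obj (ringHom g x) :=
  RingHom.congr_fun (congrArg ringHom (toAway_awayMap g hd)) x

/-- The restriction `C[1/f] → C[1/h]` to a smaller basic open set. -/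
noncomputable def awayRestrict {f h : C.obj} (hd : f ∣ h) : C.away f ⟶ C.away h :=
  awayLift (C.toAway h) (isUnit_toAway_of_dvd hd)

theorem toAway_awayRestrict {f h : C.obj} (hd : f ∣ h) :
    C.toAway f ≫ awayRestrict hd = C.toAway h :=
  toAway_awayLift _ _

theorem awayRestrict_awayMap (g : C ⟶ D) {f h : C.obj} (hd : f ∣ h) :
    awayRestrict hd ≫ awayMap g (dvd_refl (ringHom g h)) =
      awayMap g (dvd_refl (ringHom g f)) ≫ awayRestrict (map_dvd (ringHom g) hd) :=
  away_hom_ext (by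
    rw [← Category.assoc, ← Category.assoc, toAway_awayRestrict, toAway_awayMap, toAway_awayMap,
      Category.assoc, toAway_awayRestrict])

theorem exists_away_mul_factorization {f g : C.obj} {α : C.away f ⟶ D} {β : C.away g ⟶ D}
    (h : C.toAway f ≫ α = C.toAway g ≫ β) : ∃ γ : C.away (f * g) ⟶ D,
      awayRestrict (dvd_mul_right f g) ≫ γ = α ∧ awayRestrict (dvd_mul_left g f) ≫ γ = β := by
  have hu : IsUnit (ringHom (C.toAway f ≫ α) (f * g)) := by
    rw [map_mul]
    refine .mul ((isUnit_toAway_of_dvd dvd_rfl).map (ringHom α)) ?_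
    rw [h]
    exact (isUnit_toAway_of_dvd dvd_rfl).map (ringHom β)
  refine ⟨awayLift _ hu, away_hom_ext ?_, away_hom_ext ?_⟩
  · rw [← Category.assoc, toAway_awayRestrict, toAway_awayLift]
  · rw [← Category.assoc, toAway_awayRestrict, toAway_awayLift, h]

end Nilp

section NilSquares

open Nilp

theorem IsFibreSquare.algHom_comp {R A P W S C : Type*} [CommRing R] [CommRing A] [CommRing P]
    [CommRing W] [CommRing S] [CommRing C] [Algebra R A] [Algebra R P] [Algebra R W] [Algebra R S]
    [Algebra R C] {a : P →ₐ[R] W} {b : P →ₐ[R] S} {c : W →ₐ[R] C} {d : S →ₐ[R] C}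
    (h : IsFibreSquare a b c d) :
    IsFibreSquare (fun k : A →ₐ[R] P => a.comp k) (fun k : A →ₐ[R] P => b.comp k)
      (fun k => c.comp k) (fun k => d.comp k) where
  comm k := AlgHom.ext fun t => h.comm (k t)
  existsUnique f g hfg := by
    choose k hk using fun t => (h.existsUnique (f t) (g t) (DFunLike.congr_fun hfg t)).exists
    refine ⟨{ toFun := k
              map_one' := h.eq_of_eq ?_ ?_
              map_mul' := fun x y => h.eq_of_eq ?_ ?_
              map_zero' := h.eq_of_eq ?_ ?_
              map_add' := fun x y => h.eq_of_eq ?_ ?_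
              commutes' := fun r => h.eq_of_eq ?_ ?_ },
      ⟨AlgHom.ext fun t => (hk t).1, AlgHom.ext fun t => (hk t).2⟩,
      fun k' ⟨hka, hkb⟩ => AlgHom.ext fun t => h.eq_of_eq ?_ ?_⟩
    case refine_11 => exact (DFunLike.congr_fun hka t).trans (hk t).1.symm
    case refine_12 => exact (DFunLike.congr_fun hkb t).trans (hk t).2.symm
    all_goals simp [(hk _).1, (hk _).2]

variable {R : Type u} [CommRing R] {ϖ : R}

/-- A fibre square of algebras in `Nilp ϖ` in which `W → C` is a nil thickening. -/
structure IsNilSquare {P W S C : Nilp ϖ} (a : P ⟶ W) (b : P ⟶ S) (c : W ⟶ C) (d : S ⟶ C) :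
    Prop where
  isFibreSquare : IsFibreSquare (ringHom a) (ringHom b) (ringHom c) (ringHom d)
  isNilThickening : IsNilThickening (ringHom c)

namespace IsNilSquare

variable {P W S C : Nilp ϖ} {a : P ⟶ W} {b : P ⟶ S} {c : W ⟶ C} {d : S ⟶ C}

theorem comm (h : IsNilSquare a b c d) : a ≫ c = b ≫ d :=
  hom_ext h.isFibreSquare.comm

theorem isNilThickening_right (h : IsNilSquare a b c d) :
    IsNilThickening (ringHom b) :=
  h.isNilThickening.of_isFibreSquare h.isFibreSquare

theorem away (h : IsNilSquare a b c d) (f : P.obj) :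
    IsNilSquare (awayMap a (dvd_refl (ringHom a f))) (awayMap b (dvd_refl (ringHom b f)))
      (awayMap c (dvd_refl (ringHom c (ringHom a f))))
      (awayMap d (h.isFibreSquare.comm f).symm.dvd) where
  isFibreSquare := h.isFibreSquare.of_away f (awayMap_algebraMap a _) (awayMap_algebraMap b _)
    (awayMap_algebraMap c _) (awayMap_algebraMap d _)
  isNilThickening := h.isNilThickening.of_away (ringHom a f) (awayMap_algebraMap c _)

theorem isFibreSquare_spf (h : IsNilSquare a b c d) (A : Type u) [CommRing A] [Algebra R A]
    (I : Ideal A) : IsFibreSquare ((Spf ϖ A I).map a) ((Spf ϖ A I).map b) ((Spf ϖ A I).map c)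
      ((Spf ϖ A I).map d) where
  comm k := Subtype.ext (h.isFibreSquare.algHom_comp.comm k.1)
  existsUnique := by
    rintro ⟨f, i, hi⟩ ⟨g, j, hj⟩ hfg
    obtain ⟨k, ⟨rfl, rfl⟩, -⟩ :=
      h.isFibreSquare.algHom_comp.existsUnique f g (congrArg Subtype.val hfg)
    refine ⟨⟨k, i + j, fun t ht => h.isFibreSquare.eq_of_eq ?_ ?_⟩, ⟨rfl, rfl⟩,
      fun k' ⟨hka, hkb⟩ => Subtype.ext (h.isFibreSquare.algHom_comp.eq_of_eq
        (congrArg Subtype.val hka) (congrArg Subtype.val hkb))⟩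
    · exact (hi (Ideal.pow_le_pow_right (Nat.le_add_right i j) ht)).trans (map_zero _).symm
    · exact (hj (Ideal.pow_le_pow_right (Nat.le_add_left j i) ht)).trans (map_zero _).symm

end IsNilSquare

theorem IsFibreSquare.of_natIso {𝒞 : Type*} [Category 𝒞] {F G : 𝒞 ⥤ Type u} (e : F ≅ G)
    {P W S C : 𝒞} {a : P ⟶ W} {b : P ⟶ S} {c : W ⟶ C} {d : S ⟶ C}
    (h : IsFibreSquare (G.map a) (G.map b) (G.map c) (G.map d)) :
    IsFibreSquare (F.map a) (F.map b) (F.map c) (F.map d) :=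
  h.of_equiv (e.app P).toEquiv (e.app W).toEquiv (e.app S).toEquiv (e.app C).toEquiv
    (NatTrans.naturality_apply e.hom a) (NatTrans.naturality_apply e.hom b)
    (NatTrans.naturality_apply e.hom c) (NatTrans.naturality_apply e.hom d)

variable {F : Nilp ϖ ⥤ Type u}

theorem IsFormalAffine.isFibreSquare_map (hF : IsFormalAffine F) {P W S C : Nilp ϖ} {a : P ⟶ W}
    {b : P ⟶ S} {c : W ⟶ C} {d : S ⟶ C} (h : IsNilSquare a b c d) :
    IsFibreSquare (F.map a) (F.map b) (F.map c) (F.map d) := by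
  obtain ⟨A, I, -, -, ⟨e⟩⟩ := hF
  exact .of_natIso e (h.isFibreSquare_spf A I)

namespace IsOpenSubfunctor

variable {U : Subfunctor F}

theorem mem_of_map_mem (hU : IsOpenSubfunctor U) {A B : Nilp ϖ} {f : A ⟶ B}
    (hf : IsNilThickening (ringHom f)) {x : F.obj A}
    (hx : F.map f x ∈ U.obj B) : x ∈ U.obj A := by
  obtain ⟨J, hJ⟩ := hU A x
  have hJ_top : J = ⊤ := hf.eq_top_of_map_eq_top ((hJ B f).1 hx)
  simpa only [Functor.map_id_apply] using (hJ A (𝟙 A)).2 (by rw [hJ_top, Ideal.map_top])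

theorem existsUnique_of_mem (hU : IsOpenSubfunctor U) (hUF : IsFormalAffine U.toFunctor)
    {P W S C : Nilp ϖ} {a : P ⟶ W} {b : P ⟶ S} {c : W ⟶ C} {d : S ⟶ C}
    (h : IsNilSquare a b c d) {x : F.obj W} {y : F.obj S} (hxy : F.map c x = F.map d y)
    (hy : y ∈ U.obj S) : ∃! z, F.map a z = x ∧ F.map b z = y := by
  have hx : x ∈ U.obj W := hU.mem_of_map_mem h.isNilThickening (hxy ▸ U.map d hy)
  obtain ⟨z, ⟨hza, hzb⟩, hz⟩ :=
    (hUF.isFibreSquare_map h).existsUnique ⟨x, hx⟩ ⟨y, hy⟩ (Subtype.ext hxy)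
  refine ⟨z.1, ⟨congrArg Subtype.val hza, congrArg Subtype.val hzb⟩, fun z' ⟨hza', hzb'⟩ => ?_⟩
  have hz' : z' ∈ U.obj P := hU.mem_of_map_mem h.isNilThickening_right (hzb' ▸ hy)
  exact congrArg Subtype.val (hz ⟨z', hz'⟩ ⟨Subtype.ext hza', Subtype.ext hzb'⟩)

end IsOpenSubfunctor

namespace IsZariskiSheaf

theorem eq_of_map_toAway_eq (hF : IsZariskiSheaf F) {C : Nilp ϖ} {s : Set C.obj}
    (hs : Ideal.span s = ⊤) {x y : F.obj C}
    (h : ∀ f ∈ s, F.map (C.toAway f) x = F.map (C.toAway f) y) : x = y := by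
  obtain ⟨z, -, hz⟩ := hF C s hs (fun f => F.map (C.toAway f.1) y) (by
    intro f g D a b e
    rw [← F.map_comp_apply, ← F.map_comp_apply, e])
  exact (hz x fun f => h f.1 f.2).trans (hz y fun f => rfl).symm

theorem exists_map_toAway_eq (hF : IsZariskiSheaf F) {C : Nilp ϖ} {s : Set C.obj}
    (hs : Ideal.span s = ⊤) (x : ∀ f : s, F.obj (C.away f.1))
    (hx : ∀ f g : s, F.map (awayRestrict (dvd_mul_right f.1 g.1)) (x f) =
      F.map (awayRestrict (dvd_mul_left g.1 f.1)) (x g)) :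
    ∃ y : F.obj C, ∀ f : s, F.map (C.toAway f.1) y = x f := by
  refine (hF C s hs x fun f g D α β h => ?_).exists
  obtain ⟨γ, rfl, rfl⟩ := exists_away_mul_factorization h
  rw [F.map_comp_apply, F.map_comp_apply, hx]

end IsZariskiSheaf

namespace IsNilSquare

variable {P W S C : Nilp ϖ} {a : P ⟶ W} {b : P ⟶ S} {c : W ⟶ C} {d : S ⟶ C}

theorem exists_local_existsUnique (h : IsNilSquare a b c d) (hF : HasOpenCover IsFormalAffine F)
    {x : F.obj W} {y : F.obj S} (hxy : F.map c x = F.map d y) :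
    ∃ t : Set P.obj, Ideal.span t = ⊤ ∧ ∀ f ∈ t, ∃! z : F.obj (P.away f),
      F.map (awayMap a (dvd_refl (ringHom a f))) z = F.map (W.toAway (ringHom a f)) x ∧
      F.map (awayMap b (dvd_refl (ringHom b f))) z = F.map (S.toAway (ringHom b f)) y := by
  obtain ⟨𝒰, h𝒰, hcov⟩ := hF
  obtain ⟨s, hs, hsU⟩ := hcov S y
  refine ⟨ringHom b ⁻¹' s, h.isNilThickening_right.eq_top_of_map_eq_top ?_, fun f hf => ?_⟩
  · rw [Ideal.map_span, ← hs]
    exact congrArg Ideal.span (Set.image_preimage_eq s h.isNilThickening_right.surjective)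
  · obtain ⟨U, hU, hyU⟩ := hsU _ hf
    refine (h𝒰 U hU).1.existsUnique_of_mem (h𝒰 U hU).2 (h.away f) ?_ hyU
    rw [← F.map_comp_apply, ← F.map_comp_apply, toAway_awayMap, toAway_awayMap,
      F.map_comp_apply, F.map_comp_apply, hxy]

theorem eq_of_map_eq (h : IsNilSquare a b c d) (hF : IsFormalScheme F) {z z' : F.obj P}
    (ha : F.map a z = F.map a z') (hb : F.map b z = F.map b z') : z = z' := by
  obtain ⟨t, ht, hloc⟩ := h.exists_local_existsUnique hF.2 (x := F.map a z') (y := F.map b z') (by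
    rw [← F.map_comp_apply, ← F.map_comp_apply, h.comm])
  refine hF.1.eq_of_map_toAway_eq ht fun f hf => (hloc f hf).unique ⟨?_, ?_⟩ ⟨?_, ?_⟩ <;>
    rw [← F.map_comp_apply, toAway_awayMap, F.map_comp_apply] <;> simp only [ha, hb]

theorem exists_map_eq (h : IsNilSquare a b c d) (hF : IsFormalScheme F) {x : F.obj W}
    {y : F.obj S} (hxy : F.map c x = F.map d y) : ∃ z, F.map a z = x ∧ F.map b z = y := by
  obtain ⟨t, ht, hloc⟩ := h.exists_local_existsUnique hF.2 hxy
  choose ζ hζa hζb using fun f : t => (hloc f.1 f.2).exists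
  have restrict {Q : Nilp ϖ} (e : P ⟶ Q) {f k : P.obj} (hf : f ∣ k) {z : F.obj (P.away f)}
      {v : F.obj Q} (hz : F.map (awayMap e (dvd_refl (ringHom e f))) z =
        F.map (Q.toAway (ringHom e f)) v) :
      F.map (awayMap e (dvd_refl (ringHom e k))) (F.map (awayRestrict hf) z) =
        F.map (Q.toAway (ringHom e k)) v := by
    rw [← F.map_comp_apply, awayRestrict_awayMap, F.map_comp_apply, hz, ← F.map_comp_apply,
      toAway_awayRestrict]
  obtain ⟨z, hz⟩ := hF.1.exists_map_toAway_eq ht ζ fun f g =>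
    (h.away (f.1 * g.1)).eq_of_map_eq hF
      ((restrict a _ (hζa f)).trans (restrict a _ (hζa g)).symm)
      ((restrict b _ (hζb f)).trans (restrict b _ (hζb g)).symm)
  have glue {Q : Nilp ϖ} (e : P ⟶ Q) {v : F.obj Q}
      (hv : ∀ f : t, F.map (awayMap e (dvd_refl (ringHom e f.1))) (ζ f) =
        F.map (Q.toAway (ringHom e f.1)) v) : F.map e z = v := by
    refine hF.1.eq_of_map_toAway_eq (s := ringHom e '' t) ?_ ?_
    · rw [← Ideal.map_span, ht, Ideal.map_top]
    · rintro _ ⟨f, hf, rfl⟩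
      rw [← hv ⟨f, hf⟩, ← hz, ← F.map_comp_apply, ← F.map_comp_apply, toAway_awayMap]
  exact ⟨z, glue a hζa, glue b hζb⟩

theorem isFibreSquare_map (h : IsNilSquare a b c d) (hF : IsFormalScheme F) :
    IsFibreSquare (F.map a) (F.map b) (F.map c) (F.map d) where
  comm z := by rw [← F.map_comp_apply, ← F.map_comp_apply, h.comm]
  existsUnique x y hxy := by
    obtain ⟨z, rfl, rfl⟩ := h.exists_map_eq hF hxy
    exact ⟨z, ⟨rfl, rfl⟩, fun z' ⟨ha, hb⟩ => h.eq_of_map_eq hF ha hb⟩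

end IsNilSquare

end NilSquares

namespace RamifiedWitt

variable {𝒪 : Type*} [CommRing 𝒪] (π : 𝒪)

instance PiTorsionFree.mvPolynomial (σ A : Type*) [CommRing A] [Algebra 𝒪 A] [PiTorsionFree π A] :
    PiTorsionFree π (MvPolynomial σ A) where
  eq_zero P h := by
    ext s
    refine PiTorsionFree.eq_zero (π := π) _ ?_
    rw [← MvPolynomial.coeff_C_mul, ← MvPolynomial.algebraMap_apply, h, MvPolynomial.coeff_zero]

variable [IsDomain 𝒪] [hπ : Fact (Prime π)] [hfin : Finite (𝒪 ⧸ Ideal.span {π})]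

theorem exists_shiftPoly : ∃ S : ℕ → MvPolynomial ℕ 𝒪,
    ghost π S 0 = ghost π MvPolynomial.X 0 ∧
      ∀ n, ghost π S (n + 1) = ghost π MvPolynomial.X n ^ resCard π := by
  obtain ⟨S, hS⟩ := exists_poly π
    (fun n => Nat.casesOn n (ghost π MvPolynomial.X 0) fun k =>
      ghost π (MvPolynomial.X : ℕ → MvPolynomial ℕ 𝒪) k ^ resCard π) (by
    rintro (_ | k)
    · simp [ghost]
    · simpa only [map_pow] using
        dvd_pow_sub_pow (dvd_resCard π _) (ghost_dvd_poly π MvPolynomial.X k))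
  exact ⟨S, hS 0, fun n => hS (n + 1)⟩

/-- The polynomials defining the universal Witt vector with ghost components
`(w₀, w₀ ^ q, w₁ ^ q, w₂ ^ q, …)`, which is the part of `WittAlg.contract` not coming from the
Verschiebung. -/
noncomputable def shiftPoly : ℕ → MvPolynomial ℕ 𝒪 := (exists_shiftPoly π).choose

end RamifiedWitt

section WittAlgebras

variable {𝒪 : Type*} [CommRing 𝒪] {π : 𝒪} {R : Type*} [CommRing R] [Algebra 𝒪 R]

/-- The Witt vectors `W_m(C)` of an `R`-algebra `C`, as a type that remembers the lift of Frobenius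
`φ` of `R`, on which their `R`-algebra structure depends. -/
def WittAlg (_φ : FrobLift π R) (m : ℕ) (C : Type*) : Type _ := WittVec π m C

namespace WittAlg

variable {φ : FrobLift π R} {m : ℕ} {C : Type*} [CommRing C]

/-- The Verschiebung `(x₀, …, x_m) ↦ (0, x₀, …, x_m)`, which lengthens truncated Witt vectors by
one. -/
def verschiebung (x : WittAlg φ m C) : WittAlg φ (m + 1) C := ⟨Fin.cons 0 x.coeff⟩

theorem verschiebung_injective :
    Function.Injective (verschiebung : WittAlg φ m C → WittAlg φ (m + 1) C) := fun _ _ h =>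
  WittVec.ext (Fin.cons_right_injective (α := fun _ => C) 0 (congrArg WittVec.coeff h))

theorem exists_verschiebung_eq {x : WittAlg φ (m + 1) C} (h : x.coeff 0 = 0) :
    ∃ y, verschiebung y = x :=
  ⟨⟨Fin.tail x.coeff⟩, WittVec.ext <|
    (congrArg (Fin.cons · (Fin.tail x.coeff)) h.symm).trans (Fin.cons_self_tail x.coeff)⟩

theorem ext0_verschiebung_succ (x : WittAlg φ m C) (i : ℕ) :
    WittVec.ext0 (verschiebung x) (i + 1) = WittVec.ext0 x i :=
  dite_congr (propext Nat.succ_lt_succ_iff) (fun _ => rfl) fun _ => rfl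

variable [IsDomain 𝒪] [hπ : Fact (Prime π)] [hfin : Finite (𝒪 ⧸ Ideal.span {π})] [Algebra 𝒪 C]

/-- The Witt vector of length one more with ghost components `(w₀, w₀ ^ q, …, w_m ^ q)`. -/
noncomputable def shiftPow (x : WittAlg φ m C) : WittAlg φ (m + 1) C :=
  WittVec.trunc π (m + 1) fun i => MvPolynomial.aeval (WittVec.ext0 x) (shiftPoly π i)

noncomputable instance : CommRing (WittAlg φ m C) := inferInstanceAs (CommRing (WittVec π m C))

variable (φ m C) in
/-- The `i`-th ghost map `w_i : W_m(C) → C`. -/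
noncomputable def ghost (i : Fin (m + 1)) : WittAlg φ m C →+* C where
  toFun x := WittVec.ghost x i
  map_one' := WittVec.ghost_one i.is_le
  map_mul' x y := WittVec.ghost_mul x y i.is_le
  map_zero' := WittVec.ghost_zero i.is_le
  map_add' x y := WittVec.ghost_add x y i.is_le

theorem ghost_zero_apply (x : WittAlg φ m C) : ghost φ m C 0 x = x.coeff 0 := by
  simp [ghost, WittVec.ghost, RamifiedWitt.ghost, WittVec.ext0]

theorem ghost_one_apply (x : WittAlg φ 1 C) :
    ghost φ 1 C 1 x = x.coeff 0 ^ resCard π + algebraMap 𝒪 C π * x.coeff 1 := by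
  simp [ghost, WittVec.ghost, RamifiedWitt.ghost, WittVec.ext0, Finset.sum_range_succ]

theorem ext_ghost [PiTorsionFree π C] {x y : WittAlg φ m C}
    (h : ∀ i, ghost φ m C i x = ghost φ m C i y) : x = y :=
  WittVec.ghost_injective fun i hi => h ⟨i, Nat.lt_succ_of_le hi⟩

theorem ghost_zero_verschiebung (x : WittAlg φ m C) : ghost φ (m + 1) C 0 (verschiebung x) = 0 :=
  ghost_zero_apply _

theorem ghost_succ_verschiebung (x : WittAlg φ m C) (i : Fin (m + 1)) :
    ghost φ (m + 1) C i.succ (verschiebung x) = algebraMap 𝒪 C π * ghost φ m C i x := by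
  change RamifiedWitt.ghost π (WittVec.ext0 (verschiebung x)) (i + 1) =
    algebraMap 𝒪 C π * RamifiedWitt.ghost π (WittVec.ext0 x) i
  have h0 : WittVec.ext0 (verschiebung x) 0 = 0 := rfl
  rw [RamifiedWitt.ghost, RamifiedWitt.ghost, Finset.sum_range_succ', h0, Finset.mul_sum,
    zero_pow (pow_ne_zero _ WittVec.resCard_pos), mul_zero, add_zero]
  refine Finset.sum_congr rfl fun j _ => ?_
  rw [ext0_verschiebung_succ, Nat.add_sub_add_right, pow_succ', mul_assoc]

theorem ghost_zero_shiftPow (x : WittAlg φ m C) :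
    ghost φ (m + 1) C 0 (shiftPow x) = ghost φ m C 0 x := by
  change (WittVec.trunc π (m + 1) _).ghost 0 = RamifiedWitt.ghost π (WittVec.ext0 x) 0
  rw [WittVec.ghost_trunc _ (Nat.zero_le _), ghost_map, shiftPoly,
    (exists_shiftPoly π).choose_spec.1, ← ghost_map]
  simp only [MvPolynomial.aeval_X]

theorem ghost_succ_shiftPow (x : WittAlg φ m C) (i : Fin (m + 1)) :
    ghost φ (m + 1) C i.succ (shiftPow x) = ghost φ m C i x ^ resCard π := by
  change (WittVec.trunc π (m + 1) _).ghost (i + 1) =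
    RamifiedWitt.ghost π (WittVec.ext0 x) i ^ resCard π
  rw [WittVec.ghost_trunc _ (Nat.succ_le_succ i.is_le), ghost_map, shiftPoly,
    (exists_shiftPoly π).choose_spec.2, map_pow, ← ghost_map]
  simp only [MvPolynomial.aeval_X]

variable [PiTorsionFree π R] [Algebra R C] [IsScalarTower 𝒪 R C]

noncomputable instance : Algebra R (WittAlg φ m C) := WittVec.algebra φ m C

noncomputable instance : Algebra 𝒪 (WittAlg φ m C) :=
  Algebra.compHom (WittAlg φ m C) (algebraMap 𝒪 R)

instance : IsScalarTower 𝒪 R (WittAlg φ m C) := IsScalarTower.of_algebraMap_eq' rfl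

theorem ghost_algebraMap (i : Fin (m + 1)) (r : R) :
    ghost φ m C i (algebraMap R (WittAlg φ m C) r) = algebraMap R C (φ.φ^[i] r) :=
  (WittVec.ghost_mapFun _ (WittVec.exp φ m r) i).trans
    (congrArg (algebraMap R C) (WittVec.ghost_exp φ m r i.is_le))

theorem ghost_algebraMap_pi (i : Fin (m + 1)) :
    ghost φ m C i (algebraMap 𝒪 (WittAlg φ m C) π) = algebraMap 𝒪 C π := by
  rw [IsScalarTower.algebraMap_apply 𝒪 R, ghost_algebraMap,
    Function.iterate_fixed (φ.φ.commutes π) i, ← IsScalarTower.algebraMap_apply]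

variable {D : Type*} [CommRing D] [Algebra 𝒪 D] [Algebra R D] [IsScalarTower 𝒪 R D]

variable (φ m) in
/-- The `R`-algebra homomorphism `W_m(f) : W_m(C) → W_m(D)`. -/
noncomputable def map (f : C →ₐ[R] D) : WittAlg φ m C →ₐ[R] WittAlg φ m D where
  __ : WittAlg φ m C →+* WittAlg φ m D := WittVec.map (f.restrictScalars 𝒪)
  commutes' _ := WittVec.ext (funext fun _ => f.commutes _)

theorem map_surjective {f : C →ₐ[R] D} (hf : Function.Surjective f) :
    Function.Surjective (map φ m f) :=
  WittVec.mapFun_surjective hf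

theorem map_verschiebung (f : C →ₐ[R] D) (x : WittAlg φ m C) :
    map φ (m + 1) f (verschiebung x) = verschiebung (map φ m f x) :=
  WittVec.ext (funext fun i => Fin.cases (map_zero f) (fun _ => rfl) i)

theorem map_shiftPow (f : C →ₐ[R] D) (x : WittAlg φ m C) :
    map φ (m + 1) f (shiftPow x) = shiftPow (map φ m f x) := by
  have hx : WittVec.ext0 (map φ m f x) = fun j => f (WittVec.ext0 x j) :=
    funext (WittVec.ext0_mapFun (f.restrictScalars 𝒪) x)
  refine WittVec.ext (funext fun i => ?_)
  change f.restrictScalars 𝒪 (MvPolynomial.aeval (WittVec.ext0 x) _) = MvPolynomial.aeval _ _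
  rw [hx, ← AlgHom.comp_apply, MvPolynomial.comp_aeval]
  rfl

variable (R C) in
theorem aeval_id_surjective :
    Function.Surjective (MvPolynomial.aeval id : MvPolynomial C R →ₐ[R] C) :=
  fun c => ⟨MvPolynomial.X c, MvPolynomial.aeval_X _ _⟩

theorem verschiebung_mul_verschiebung (x y : WittAlg φ m C) :
    verschiebung x * verschiebung y = algebraMap 𝒪 _ π * verschiebung (x * y) := by
  obtain ⟨x, rfl⟩ := map_surjective (φ := φ) (m := m) (aeval_id_surjective R C) x
  obtain ⟨y, rfl⟩ := map_surjective (φ := φ) (m := m) (aeval_id_surjective R C) y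
  have hπ' : algebraMap 𝒪 (WittAlg φ (m + 1) C) π =
      map φ (m + 1) (MvPolynomial.aeval id) (algebraMap 𝒪 _ π) :=
    (((map φ (m + 1) (MvPolynomial.aeval id)).restrictScalars 𝒪).commutes π).symm
  rw [← map_mul, ← map_verschiebung, ← map_verschiebung, ← map_verschiebung, hπ', ← map_mul,
    ← map_mul]
  refine congrArg _ (ext_ghost (Fin.cases ?_ fun i => ?_))
  · simp only [map_mul, ghost_zero_verschiebung, mul_zero]
  · simp only [map_mul, ghost_succ_verschiebung, ghost_algebraMap_pi]
    ring

theorem isNilpotent_verschiebung (h : IsNilpotent (algebraMap R C (algebraMap 𝒪 R π)))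
    (x : WittAlg φ m C) : IsNilpotent (verschiebung x) := by
  have hpow (k : ℕ) :
      verschiebung x ^ (k + 1) = algebraMap 𝒪 _ π ^ k * verschiebung (x ^ (k + 1)) := by
    induction k with
    | zero => simp only [zero_add, pow_one, pow_zero, one_mul]
    | succ k ih =>
      rw [pow_succ, ih, mul_assoc, verschiebung_mul_verschiebung, ← pow_succ, pow_succ _ k,
        mul_assoc]
  obtain ⟨k, hk⟩ : IsNilpotent (algebraMap 𝒪 (WittAlg φ (m + 1) C) π) :=
    WittVec.isNilpotent φ (m + 1) h
  exact ⟨k + 1, by rw [hpow, hk, zero_mul]⟩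

/-- The map underlying `WittAlg.contract`. -/
noncomputable def contractFun (z : WittAlg φ 1 (WittAlg φ m C)) : WittAlg φ (m + 1) C :=
  shiftPow (z.coeff 0) + verschiebung (z.coeff 1)

theorem ghost_zero_contractFun (z : WittAlg φ 1 (WittAlg φ m C)) :
    ghost φ (m + 1) C 0 (contractFun z) = ghost φ m C 0 (ghost φ 1 _ 0 z) := by
  rw [contractFun, map_add, ghost_zero_shiftPow, ghost_zero_verschiebung, add_zero,
    ghost_zero_apply z]

theorem ghost_succ_contractFun (z : WittAlg φ 1 (WittAlg φ m C)) (i : Fin (m + 1)) :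
    ghost φ (m + 1) C i.succ (contractFun z) = ghost φ m C i (ghost φ 1 _ 1 z) := by
  rw [contractFun, map_add, ghost_succ_shiftPow, ghost_succ_verschiebung, ghost_one_apply z,
    map_add, map_pow, map_mul, ghost_algebraMap_pi]

theorem map_contractFun (f : C →ₐ[R] D) (z : WittAlg φ 1 (WittAlg φ m C)) :
    map φ (m + 1) f (contractFun z) = contractFun (map φ 1 (map φ m f) z) := by
  rw [contractFun, map_add, map_shiftPow, map_verschiebung]
  rfl

theorem contractFun_add (z z' : WittAlg φ 1 (WittAlg φ m C)) :
    contractFun (z + z') = contractFun z + contractFun z' := by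
  have hs := map_surjective (φ := φ) (m := 1) (map_surjective (φ := φ) (m := m)
    (aeval_id_surjective R C))
  obtain ⟨z, rfl⟩ := hs z
  obtain ⟨z', rfl⟩ := hs z'
  simp only [← map_add, ← map_contractFun]
  refine congrArg _ (ext_ghost (Fin.cases ?_ fun i => ?_))
  · simp only [map_add, ghost_zero_contractFun]
  · simp only [map_add, ghost_succ_contractFun]

theorem contractFun_mul (z z' : WittAlg φ 1 (WittAlg φ m C)) :
    contractFun (z * z') = contractFun z * contractFun z' := by
  have hs := map_surjective (φ := φ) (m := 1) (map_surjective (φ := φ) (m := m)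
    (aeval_id_surjective R C))
  obtain ⟨z, rfl⟩ := hs z
  obtain ⟨z', rfl⟩ := hs z'
  simp only [← map_mul, ← map_contractFun]
  refine congrArg _ (ext_ghost (Fin.cases ?_ fun i => ?_))
  · simp only [map_mul, ghost_zero_contractFun]
  · simp only [map_mul, ghost_succ_contractFun]

theorem contractFun_algebraMap (r : R) :
    contractFun (algebraMap R (WittAlg φ 1 (WittAlg φ m C)) r) = algebraMap R _ r := by
  rw [← (map φ 1 (map φ m (MvPolynomial.aeval id : MvPolynomial C R →ₐ[R] C))).commutes,
    ← (map φ (m + 1) (MvPolynomial.aeval id : MvPolynomial C R →ₐ[R] C)).commutes,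
    ← map_contractFun]
  refine congrArg _ (ext_ghost (Fin.cases ?_ fun i => ?_))
  · simp only [ghost_zero_contractFun, ghost_algebraMap]
    rfl
  · simp only [ghost_succ_contractFun, ghost_algebraMap]
    rfl

variable (φ m C) in
/-- The natural homomorphism `W_1(W_m(C)) → W_{m+1}(C)`. It sends a Witt vector whose ghost
components are `a` and `b`, with ghost components `a₀, …, a_m` and `b₀, …, b_m`, to the one with
ghost components `a₀, b₀, …, b_m`. -/
noncomputable def contract : WittAlg φ 1 (WittAlg φ m C) →ₐ[R] WittAlg φ (m + 1) C where
  toFun := contractFun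
  map_one' := by simpa only [map_one] using contractFun_algebraMap (φ := φ) (C := C) (1 : R)
  map_mul' := contractFun_mul
  map_zero' := by simpa only [map_zero] using contractFun_algebraMap (φ := φ) (C := C) (0 : R)
  map_add' := contractFun_add
  commutes' := contractFun_algebraMap

theorem isFibreSquare_contract :
    IsFibreSquare (contract φ m C) (ghost φ 1 (WittAlg φ m C) 0) (ghost φ (m + 1) C 0)
      (ghost φ m C 0) where
  comm := ghost_zero_contractFun
  existsUnique w s hws := by
    obtain ⟨x, hx⟩ : ∃ x, verschiebung x = w - shiftPow s := exists_verschiebung_eq <| by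
      rw [← ghost_zero_apply, map_sub, ghost_zero_shiftPow, hws, sub_self]
    refine ⟨⟨![s, x]⟩, ⟨?_, ghost_zero_apply _⟩, fun z ⟨hzw, hzs⟩ => ?_⟩
    · change shiftPow s + verschiebung x = w
      rw [hx, add_sub_cancel]
    · have h0 : z.coeff 0 = s := (ghost_zero_apply z).symm.trans hzs
      have h1 : shiftPow (z.coeff 0) + verschiebung (z.coeff 1) = w := hzw
      rw [h0, ← eq_sub_iff_add_eq', ← hx] at h1
      exact WittVec.ext (funext (Fin.forall_fin_two.2 ⟨h0, verschiebung_injective h1⟩))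

theorem isNilThickening_ghost_zero (h : IsNilpotent (algebraMap R C (algebraMap 𝒪 R π))) :
    IsNilThickening (ghost φ (m + 1) C 0) where
  surjective c := ⟨⟨fun _ => c⟩, ghost_zero_apply _⟩
  ker_le_nilradical w hw := by
    obtain ⟨x, rfl⟩ := exists_verschiebung_eq ((ghost_zero_apply w).symm.trans hw)
    exact isNilpotent_verschiebung h x

end WittAlg

end WittAlgebras

section GroupKernels

variable {R : Type u} [CommRing R] {ϖ : R} {E F G H : Nilp ϖ ⥤ GrpCat.{u}}
  {a : E ⟶ F} {b : E ⟶ G} {c : F ⟶ H} {d : G ⟶ H}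

/-- The homomorphism that `a` induces between the kernels of the two vertical maps of the square
`c ∘ a = d ∘ b`. -/
def groupKernelMap (h : ∀ C, IsFibreSquare (a.app C) (b.app C) (c.app C) (d.app C))
    (C : Nilp ϖ) : (groupKernel b).obj C →* (groupKernel c).obj C :=
  ((a.app C).hom.comp (b.app C).hom.ker.subtype).codRestrict (c.app C).hom.ker fun x =>
    ((h C).comm x.1).trans ((congrArg (d.app C).hom x.2).trans (map_one (d.app C).hom))

theorem groupKernelMap_bijective
    (h : ∀ C, IsFibreSquare (a.app C) (b.app C) (c.app C) (d.app C)) (C : Nilp ϖ) :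
    Function.Bijective (groupKernelMap h C) := by
  refine ⟨fun x y hxy => Subtype.ext ((h C).eq_of_eq (congrArg Subtype.val hxy)
    (x.2.trans y.2.symm)), fun y => ?_⟩
  obtain ⟨x, ⟨hxa, hxb⟩, -⟩ := (h C).existsUnique y.1 1 (y.2.trans (map_one (d.app C).hom).symm)
  exact ⟨⟨x, hxb⟩, Subtype.ext hxa⟩

/-- Parallel maps of a fibre square of functors to groups have isomorphic kernels. -/
noncomputable def groupKernelIso
    (h : ∀ C, IsFibreSquare (a.app C) (b.app C) (c.app C) (d.app C)) :
    groupKernel b ≅ groupKernel c :=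
  NatIso.ofComponents
    (fun C => (MulEquiv.ofBijective _ (groupKernelMap_bijective h C)).toGrpIso) fun {C D} f => by
    ext x
    exact Subtype.ext (ConcreteCategory.congr_hom (a.naturality f) x.1)

end GroupKernels

section Jets

variable {𝒪 : Type*} [CommRing 𝒪] {π : 𝒪} [IsDomain 𝒪] [hπ : Fact (Prime π)]
  [hfin : Finite (𝒪 ⧸ Ideal.span {π})] {R : Type u} [CommRing R] [Algebra 𝒪 R]
  [PiTorsionFree π R] (φ : FrobLift π R) (m : ℕ)

attribute [local instance] restrictAlgebra restrictAlgebra_tower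

/-- `WittAlg.contract` as a natural transformation. -/
noncomputable def wittContract : wittFunctor φ m ⋙ wittFunctor φ 1 ⟶ wittFunctor φ (m + 1) where
  app C := ObjectProperty.homMk (ConcreteCategory.ofHom (C := CommAlgCat R)
    (X := (wittObj φ 1 (wittObj φ m C)).obj) (Y := (wittObj φ (m + 1) C).obj)
    (WittAlg.contract φ m C.obj))
  naturality _ _ f := Nilp.hom_ext fun z => (WittAlg.map_contractFun f.hom.hom z).symm

theorem ringHom_wittProj (C : Nilp (algebraMap 𝒪 R π)) :
    Nilp.ringHom ((wittProj φ m).app C) = WittAlg.ghost φ m C.obj 0 :=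
  RingHom.ext fun x => (WittAlg.ghost_zero_apply (φ := φ) (C := C.obj) x).symm

theorem isNilSquare_wittContract (C : Nilp (algebraMap 𝒪 R π)) :
    IsNilSquare ((wittContract φ m).app C) ((wittProj φ 1).app ((wittFunctor φ m).obj C))
      ((wittProj φ (m + 1)).app C) ((wittProj φ m).app C) where
  isFibreSquare := by
    rw [ringHom_wittProj, ringHom_wittProj, ringHom_wittProj]
    exact WittAlg.isFibreSquare_contract
  isNilThickening := by
    rw [ringHom_wittProj]
    exact WittAlg.isNilThickening_ghost_zero C.property

theorem theoremt_general (G : Nilp (algebraMap 𝒪 R π) ⥤ GrpCat.{u})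
    (hG : IsFormalScheme (G ⋙ forget GrpCat.{u})) :
    Nonempty (jetKernel φ (m + 1) G ≅ jet φ m (jetKernel φ 1 G)) := by
  have h (C : Nilp (algebraMap 𝒪 R π)) := (isNilSquare_wittContract φ m C).isFibreSquare_map hG
  exact ⟨(groupKernelIso (a := Functor.whiskerRight (wittContract φ m) G)
    (b := Functor.whiskerLeft (wittFunctor φ m) (jetProj φ 1 G)) (c := jetProj φ (m + 1) G)
    (d := jetProj φ m G) h).symm⟩

end Jets

theorem theoremt (p : ℕ) [Fact p.Prime]
    (K : Type*) [Field K] [Algebra ℚ_[p] K] [FiniteDimensional ℚ_[p] K]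
    [Algebra ℤ_[p] K] [IsScalarTower ℤ_[p] ℚ_[p] K]
    (π : integralClosure ℤ_[p] K) [Fact (Prime π)]
    (R : Type u) [CommRing R] [Algebra (integralClosure ℤ_[p] K) R] [PiTorsionFree π R]
    [IsAdicComplete (Ideal.span {algebraMap (integralClosure ℤ_[p] K) R π}) R]
    (φ : FrobLift π R)
    (G : Nilp (algebraMap (integralClosure ℤ_[p] K) R π) ⥤ GrpCat.{u})
    (hG : IsSmoothFormalGroupScheme G) (n : ℕ) (hn : 1 ≤ n) :
    Nonempty (jetKernel φ n G ≅ jet φ (n - 1) (jetKernel φ 1 G)) := by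
  obtain ⟨m, rfl⟩ := Nat.exists_eq_add_of_le' hn
  exact theoremt_general φ m G hG.1
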